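/- **Theorem 9.** Let $m,n,p,q,d\in\mathbb N$, $\nu=n+p$, $r>0$. Consider the input-delay system with state $x(t)\in\mathbb R^n$, input $u(t)\in\mathbb R^p$, $\chi=\mathrm{col}(x,u)$, disturbance $w\in L^2([t_0,\infty);\mathbb R^q)$ and regulated output $z(t)\in\mathbb R^m$, together with the dynamical state feedback controller operating under the disturbance (for almost all $t\ge t_0$): $$\dot x(t)=Ax(t)+Bu(t-r)+D_1w(t),\qquad \dot u(t)=K_1\chi(t)+K_2\chi(t-r)+\int_{-r}^0K_3F(\tau)\chi(t+\tau)\,d\tau+D_2w(t),$$ $$z(t)=C_1\chi(t)+C_2\chi(t-r)+\int_{-r}^0\tilde C_3(\tau)\chi(t+\tau)\,d\tau+D_3w(t),\qquad \chi(t_0+\theta)=\psi(\theta),\ \theta\in[-r,0],$$ with $\psi\in C([-r,0];\mathbb R^\nu)$ (sup norm of the Euclidean norm), and the supply rate $$\mathfrak s(z,w)=\begin{bmatrix}z\\w\end{bmatrix}^\top\begin{bmatrix}\tilde J^\top J_1^{-1}\tilde J&J_2\\J_2^\top&J_3\end{bmatrix}\begin{bmatrix}z\\w\end{bmatrix},\qquad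 J_1^{-1}\prec0,\quad J_3=J_3^\top,\quad \tilde J\in\mathbb R^{m\times m},\ J_2\in\mathbb R^{m\times q}.$$ Suppose $f\in C^1([-r,0];\mathbb R^d)$ and $\Pi\in\mathbb R^{d\times d}$ satisfy $f'(\tau)=\Pi f(\tau)$ and $F^{-1}:=\int_{-r}^0f(\tau)f(\tau)^\top d\tau\succ0$; put $F(\tau):=\sqrt F f(\tau)\otimes I_\nu\in\mathbb R^{d\nu\times\nu}$ and $\widehat\Pi:=\sqrt F\,\Pi\,\sqrt{F^{-1}}\otimes I_\nu$, and suppose $\tilde C_3(\tau)=C_3F(\tau)$ on $[-r,0]$ with $C_3\in\mathbb R^{m\times d\nu}$. Let $\mathrm{Sy}(X)=X+X^\top$ and let $\oplus$ denote the diagonal sum. Suppose that there are symmetric $P,S,U\in\mathbb R^{\nu\times\nu}$, $R\in\mathbb R^{d\nu\times d\nu}$, and $Q\in\mathbb R^{\nu\times d\nu}$, $[K_1\ K_2\ K_3]\in\mathbb R^{p\times(2\nu+d\nu)}$ with $$\begin{bmatrix}P&Q\\Q^\top&R+I_d\otimes S\end{bmatrix}\succ0,\quad S\succ0,\quad U\succ0,\qquad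 \Phi+\mathrm{Sy}\bigl(\mathbf P^\top(\mathbf A+\mathbf B\mathbf K)\bigr)\prec0,$$ where $\mathbf P=[P\ \ 0_{\nu\times\nu}\ \ Q\ \ 0_{\nu\times q}\ \ 0_{\nu\times m}]$, $\mathbf K=[K_1\ K_2\ K_3\ 0_{p\times(q+m)}]$, $\mathbf B=\begin{bmatrix}0_{n\times p}\\I_p\end{bmatrix}$, $$\mathbf A=\begin{bmatrix}A&0_{n\times\nu}&B&0_{n\times d\nu}&D_1&0_{n\times m}\\0_{p\times n}&0_{p\times\nu}&0_{p\times p}&0_{p\times d\nu}&D_2&0_{p\times m}\end{bmatrix},$$ $$\Phi=\mathrm{Sy}\left(\begin{bmatrix}Q\\0_{\nu\times d\nu}\\R\\0_{(q+m)\times d\nu}\end{bmatrix}\bigl[F(0)\ \ -F(-r)\ \ -\widehat\Pi\ \ 0_{d\nu\times(q+m)}\bigr]\right)+(S+rU)\oplus(-S)\oplus(-I_d\otimes U)\oplus(-J_3)\oplus J_1+\mathrm{Sy}\left(\begin{bmatrix}0_{(2\nu+d\nu)\times m}\\-J_2^\top\\\tilde J\end{bmatrix}[C_1\ C_2\ C_3\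 D_3\ 0_{m\times m}]\right).$$ Then, for the closed loop with these gains: 1. it is dissipative for $\mathfrak s$: there is a differentiable functional $v:C([-r,0];\mathbb R^\nu)\to\mathbb R$ such that for all $t_0$, $\psi$, $w$ and every (locally absolutely continuous) solution, with $\chi_t(\theta)=\chi(t+\theta)$, the function $t\mapsto v(\chi_t)$ is locally absolutely continuous on $[t_0,\infty)$ and $\frac{d}{dt}v(\chi_t)-\mathfrak s(z(t),w(t))\le0$ for almost all $t\ge t_0$; 2. for $w\equiv0$ the trivial solution is uniformly (in $t_0$) asymptotically stable, globally in $\psi$, and exponentially stable: $\|\chi(t)\|_2\le c\,e^{-\alpha(t-t_0)}\sup_{\theta\in[-r,0]}\|\psi(\theta)\|_2$ for $t\ge t_0$, with $c,\alpha>0$ independent of $t_0$, $\psi$. Moreover, the number of scalar decision variables in $(P,Q,R,S,U,[K_1\ K_2\ K_3])$ is $(0.5d^2+d+1.5)\nu^2+(0.5d+pd+2p+1.5)\nu$, which is $\mathcal O(d^2\nu^2)$ (over $d\ge1$ and all $n,p$). -/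

import Mathlib

open MeasureTheory Set
open scoped Matrix Kronecker MatrixOrder

noncomputable section

namespace InputDelay

/-- Index set of the `ν = n + p` coordinates of the closed-loop state `χ = col(x, u)`. -/
abbrev StateIx (n p : ℕ) : Type := Fin n ⊕ Fin p

/-- The state space `ℝ^ν` with the Euclidean norm. -/
abbrev State (n p : ℕ) : Type := EuclideanSpace ℝ (StateIx n p)

/-- Index set of the `dν` coordinates of `F(τ) χ`. -/
abbrev KerIx (n p d : ℕ) : Type := Fin d × StateIx n p

/-- Index set of size `2ν + dν + q + m` of the matrix inequality. -/
abbrev BlockIx (n p d q m : ℕ) : Type :=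
  StateIx n p ⊕ (StateIx n p ⊕ (KerIx n p d ⊕ (Fin q ⊕ Fin m)))

/-- The space `C([-r,0]; ℝ^ν)` with the sup norm. -/
abbrev History (n p : ℕ) (r : ℝ) : Type := C(Icc (-r) 0, State n p)

/-- Matrix-vector product between Euclidean spaces. -/
abbrev mulE {ι κ : Type} [Fintype ι] [Fintype κ] [DecidableEq κ] (M : Matrix ι κ ℝ)
    (x : EuclideanSpace ℝ κ) : EuclideanSpace ℝ ι :=
  Matrix.toEuclideanLin M x

/-- `Sy(X) = X + Xᵀ`. -/
def Sy {ι : Type} (X : Matrix ι ι ℝ) : Matrix ι ι ℝ := X + Xᵀ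

/-- Diagonal sum `X ⊕ Y`. -/
def dsum {ι κ : Type} (X : Matrix ι ι ℝ) (Y : Matrix κ κ ℝ) : Matrix (ι ⊕ κ) (ι ⊕ κ) ℝ :=
  Matrix.fromBlocks X 0 0 Y

/-! ### The basis functions -/

/-- The Gram matrix `∫_{-r}^0 f(τ) f(τ)ᵀ dτ`, that is, `F⁻¹`. -/
def gram {d : ℕ} (r : ℝ) (f : ℝ → Fin d → ℝ) : Matrix (Fin d) (Fin d) ℝ :=
  Matrix.of fun i j => ∫ τ in (-r)..0, f τ i * f τ j

/-- `√F`, where `F` is the inverse of the Gram matrix. -/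
def sqrtF {d : ℕ} (r : ℝ) (f : ℝ → Fin d → ℝ) : Matrix (Fin d) (Fin d) ℝ :=
  CFC.sqrt (gram r f)⁻¹

/-- The kernel `F(τ) = √F f(τ) ⊗ I_ν`, a matrix with `dν` rows and `ν` columns. -/
def kernelF (n p : ℕ) {d : ℕ} (r : ℝ) (f : ℝ → Fin d → ℝ) (τ : ℝ) :
    Matrix (KerIx n p d) (StateIx n p) ℝ :=
  Matrix.of fun i j =>
    (sqrtF r f *ᵥ f τ) i.1 * (1 : Matrix (StateIx n p) (StateIx n p) ℝ) i.2 j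

/-- `Π̂ = √F Π √(F⁻¹) ⊗ I_ν`. -/
def PiHat (n p : ℕ) {d : ℕ} (r : ℝ) (f : ℝ → Fin d → ℝ) (Pi : Matrix (Fin d) (Fin d) ℝ) :
    Matrix (KerIx n p d) (KerIx n p d) ℝ :=
  (sqrtF r f * Pi * CFC.sqrt (gram r f)) ⊗ₖ (1 : Matrix (StateIx n p) (StateIx n p) ℝ)

/-! ### Plant, controller, closed loop -/

/-- The data of the input-delay plant (with regulated output), together with the matrix `D₂`
through which the disturbance enters the controller dynamics. -/
structure Plant (n p q m : ℕ) where
  A : Matrix (Fin n) (Fin n) ℝ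
  B : Matrix (Fin n) (Fin p) ℝ
  D₁ : Matrix (Fin n) (Fin q) ℝ
  D₂ : Matrix (Fin p) (Fin q) ℝ
  C₁ : Matrix (Fin m) (StateIx n p) ℝ
  C₂ : Matrix (Fin m) (StateIx n p) ℝ
  Ct₃ : ℝ → Matrix (Fin m) (StateIx n p) ℝ
  D₃ : Matrix (Fin m) (Fin q) ℝ

/-- The gains of the dynamical state feedback controller. -/
structure Gains (n p d : ℕ) where
  K₁ : Matrix (Fin p) (StateIx n p) ℝ
  K₂ : Matrix (Fin p) (StateIx n p) ℝ
  K₃ : Matrix (Fin p) (KerIx n p d) ℝ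

/-- The component `x` of `χ = col(x, u)`. -/
def State.x {n p : ℕ} (χ : State n p) : EuclideanSpace ℝ (Fin n) :=
  WithLp.toLp 2 fun i => χ (Sum.inl i)

/-- The component `u` of `χ = col(x, u)`. -/
def State.u {n p : ℕ} (χ : State n p) : EuclideanSpace ℝ (Fin p) :=
  WithLp.toLp 2 fun i => χ (Sum.inr i)

/-- `χ = col(x, u)`. -/
def State.col {n p : ℕ} (x : EuclideanSpace ℝ (Fin n)) (u : EuclideanSpace ℝ (Fin p)) :
    State n p :=
  WithLp.toLp 2 (Sum.elim x u)

section ClosedLoop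

variable {n p d q m : ℕ}

/-- `A x(t) + B u(t - r) + D₁ w(t)`. -/
def plantField (G : Plant n p q m) (r : ℝ) (w : ℝ → EuclideanSpace ℝ (Fin q))
    (χ : ℝ → State n p) (t : ℝ) : EuclideanSpace ℝ (Fin n) :=
  mulE G.A (State.x (χ t)) + mulE G.B (State.u (χ (t - r))) + mulE G.D₁ (w t)

/-- `K₁ χ(t) + K₂ χ(t - r) + ∫_{-r}^0 K₃ F(τ) χ(t + τ) dτ + D₂ w(t)`. -/
def controllerField (G : Plant n p q m) (K : Gains n p d) (r : ℝ) (f : ℝ → Fin d → ℝ)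
    (w : ℝ → EuclideanSpace ℝ (Fin q)) (χ : ℝ → State n p) (t : ℝ) :
    EuclideanSpace ℝ (Fin p) :=
  mulE K.K₁ (χ t) + mulE K.K₂ (χ (t - r))
    + (∫ τ in (-r)..0, mulE (K.K₃ * kernelF n p r f τ) (χ (t + τ))) + mulE G.D₂ (w t)

/-- The regulated output
`z(t) = C₁ χ(t) + C₂ χ(t - r) + ∫_{-r}^0 C̃₃(τ) χ(t + τ) dτ + D₃ w(t)`. -/
def output (G : Plant n p q m) (r : ℝ) (w : ℝ → EuclideanSpace ℝ (Fin q))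
    (χ : ℝ → State n p) (t : ℝ) : EuclideanSpace ℝ (Fin m) :=
  mulE G.C₁ (χ t) + mulE G.C₂ (χ (t - r))
    + (∫ τ in (-r)..0, mulE (G.Ct₃ τ) (χ (t + τ))) + mulE G.D₃ (w t)

/-- `χ : [t₀ - r, ∞) → ℝ^ν` solves the closed-loop system with disturbance `w` and initial
condition `ψ` (Carathéodory solution; the values of `χ` before `t₀ - r` play no role). -/
structure IsSolution (G : Plant n p q m) (K : Gains n p d) (r : ℝ) (f : ℝ → Fin d → ℝ)
    (t₀ : ℝ) (ψ : History n p r) (w : ℝ → EuclideanSpace ℝ (Fin q)) (χ : ℝ → State n p) :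
    Prop where
  initial : ∀ θ : Icc (-r) 0, χ (t₀ + θ) = ψ θ
  continuousOn : ContinuousOn χ (Ici (t₀ - r))
  absCont : ∀ T, t₀ ≤ T → AbsolutelyContinuousOnInterval χ t₀ T
  deriv : ∀ᵐ t ∂volume.restrict (Ici t₀),
    HasDerivAt χ (State.col (plantField G r w χ t) (controllerField G K r f w χ t)) t

open Classical in
/-- The segment `χ_t(θ) = χ(t + θ)`, `θ ∈ [-r,0]`, as an element of `C([-r,0]; ℝ^ν)`. (The
default value is irrelevant: segments of solutions at `t ≥ t₀` are continuous.) -/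
def chiSegment (r : ℝ) (χ : ℝ → State n p) (t : ℝ) : History n p r :=
  if h : Continuous fun θ : Icc (-r) 0 => χ (t + θ) then ⟨_, h⟩ else 0

/-! ### Supply rate, dissipativity, stability -/

/-- The matrices of the quadratic supply rate. -/
structure Supply (q m : ℕ) where
  Jt : Matrix (Fin m) (Fin m) ℝ
  J₁ : Matrix (Fin m) (Fin m) ℝ
  J₂ : Matrix (Fin m) (Fin q) ℝ
  J₃ : Matrix (Fin q) (Fin q) ℝ

/-- The supply rate `s(z, w) = col(z, w)ᵀ [J̃ᵀ J₁⁻¹ J̃, J₂; J₂ᵀ, J₃] col(z, w)`. -/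
def Supply.rate (J : Supply q m) (z : EuclideanSpace ℝ (Fin m))
    (w : EuclideanSpace ℝ (Fin q)) : ℝ :=
  Sum.elim z w ⬝ᵥ
    (Matrix.fromBlocks (J.Jtᵀ * J.J₁⁻¹ * J.Jt) J.J₂ J.J₂ᵀ J.J₃ *ᵥ Sum.elim z w)

/-- Dissipativity: there is a differentiable functional `v` on `C([-r,0]; ℝ^ν)` such that along
every solution, for every `t₀`, every initial condition and every `L²` disturbance,
`t ↦ v(χ_t)` is locally absolutely continuous on `[t₀, ∞)` and, for almost all `t ≥ t₀`,
differentiable with `d/dt v(χ_t) - s(z(t), w(t)) ≤ 0`. -/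
def IsDissipative (G : Plant n p q m) (K : Gains n p d) (r : ℝ) (f : ℝ → Fin d → ℝ)
    (J : Supply q m) : Prop :=
  ∃ v : History n p r → ℝ, Differentiable ℝ v ∧
    ∀ (t₀ : ℝ) (ψ : History n p r) (w : ℝ → EuclideanSpace ℝ (Fin q)) (χ : ℝ → State n p),
      MemLp w 2 (volume.restrict (Ici t₀)) → IsSolution G K r f t₀ ψ w χ →
      (∀ T, t₀ ≤ T → AbsolutelyContinuousOnInterval (fun t => v (chiSegment r χ t)) t₀ T) ∧
      ∀ᵐ t ∂volume.restrict (Ici t₀), ∃ v' : ℝ,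
        HasDerivAt (fun s => v (chiSegment r χ s)) v' t ∧
        v' - J.rate (output G r w χ t) (w t) ≤ 0

/-- The trivial solution of the closed loop with `w ≡ 0` is uniformly stable, and uniformly
attractive for all initial conditions. -/
def IsUniformlyAsymptoticallyStable (G : Plant n p q m) (K : Gains n p d) (r : ℝ)
    (f : ℝ → Fin d → ℝ) : Prop :=
  (∀ ε > 0, ∃ δ > 0, ∀ (t₀ : ℝ) (ψ : History n p r) (χ : ℝ → State n p),
    IsSolution G K r f t₀ ψ (fun _ => 0) χ → ‖ψ‖ < δ → ∀ t ≥ t₀, ‖χ t‖ < ε) ∧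
  (∀ ρ > 0, ∀ ε > 0, ∃ T ≥ 0, ∀ (t₀ : ℝ) (ψ : History n p r) (χ : ℝ → State n p),
    IsSolution G K r f t₀ ψ (fun _ => 0) χ → ‖ψ‖ ≤ ρ → ∀ t ≥ t₀ + T, ‖χ t‖ < ε)

/-- The trivial solution of the closed loop with `w ≡ 0` is (uniformly, globally) exponentially
stable. -/
def IsExponentiallyStable (G : Plant n p q m) (K : Gains n p d) (r : ℝ)
    (f : ℝ → Fin d → ℝ) : Prop :=
  ∃ c > 0, ∃ α > 0, ∀ (t₀ : ℝ) (ψ : History n p r) (χ : ℝ → State n p),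
    IsSolution G K r f t₀ ψ (fun _ => 0) χ →
      ∀ t ≥ t₀, ‖χ t‖ ≤ c * Real.exp (-α * (t - t₀)) * ‖ψ‖

/-! ### The matrix inequality -/

/-- `𝐏 = [P, 0, Q, 0, 0]`. -/
def bigP (q m : ℕ) (P : Matrix (StateIx n p) (StateIx n p) ℝ)
    (Q : Matrix (StateIx n p) (KerIx n p d) ℝ) :
    Matrix (StateIx n p) (BlockIx n p d q m) ℝ :=
  Matrix.fromCols P (Matrix.fromCols 0 (Matrix.fromCols Q (Matrix.fromCols 0 0)))

/-- `𝐀 = [A 0, 0 B, 0, D₁, 0; 0 0, 0 0, 0, D₂, 0]`. -/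
def bigA (d : ℕ) (G : Plant n p q m) : Matrix (StateIx n p) (BlockIx n p d q m) ℝ :=
  Matrix.fromCols (Matrix.fromBlocks G.A 0 0 0)
    (Matrix.fromCols (Matrix.fromBlocks 0 G.B 0 0)
      (Matrix.fromCols 0 (Matrix.fromCols (Matrix.fromRows G.D₁ G.D₂) 0)))

/-- `𝐁 = [0; I_p]`. -/
def bigB (n p : ℕ) : Matrix (StateIx n p) (Fin p) ℝ := Matrix.fromRows 0 1

/-- `𝐊 = [K₁, K₂, K₃, 0]`. -/
def bigK (q m : ℕ) (K : Gains n p d) : Matrix (Fin p) (BlockIx n p d q m) ℝ :=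
  Matrix.fromCols K.K₁ (Matrix.fromCols K.K₂ (Matrix.fromCols K.K₃ 0))

/-- `[Σ, 0] = [C₁, C₂, C₃, D₃, 0]`. -/
def bigSigma (G : Plant n p q m) (C₃ : Matrix (Fin m) (KerIx n p d) ℝ) :
    Matrix (Fin m) (BlockIx n p d q m) ℝ :=
  Matrix.fromCols G.C₁ (Matrix.fromCols G.C₂ (Matrix.fromCols C₃ (Matrix.fromCols G.D₃ 0)))

/-- The column `[Q; 0; R; 0; 0]`. -/
def colQR (q m : ℕ) (Q : Matrix (StateIx n p) (KerIx n p d) ℝ)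
    (R : Matrix (KerIx n p d) (KerIx n p d) ℝ) :
    Matrix (BlockIx n p d q m) (KerIx n p d) ℝ :=
  Matrix.fromRows Q (Matrix.fromRows 0 (Matrix.fromRows R 0))

/-- The row `[F(0), -F(-r), -Π̂, 0]`. -/
def rowF (q m : ℕ) (r : ℝ) (f : ℝ → Fin d → ℝ) (Pi : Matrix (Fin d) (Fin d) ℝ) :
    Matrix (KerIx n p d) (BlockIx n p d q m) ℝ :=
  Matrix.fromCols (kernelF n p r f 0) (Matrix.fromCols (-kernelF n p r f (-r))
    (Matrix.fromCols (-PiHat n p r f Pi) 0))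

/-- The column `[0; 0; 0; -J₂ᵀ; J̃]`. -/
def colJ (n p d : ℕ) (J : Supply q m) : Matrix (BlockIx n p d q m) (Fin m) ℝ :=
  Matrix.fromRows 0 (Matrix.fromRows 0 (Matrix.fromRows 0 (Matrix.fromRows (-J.J₂ᵀ) J.Jt)))

/-- The matrix `Φ`. -/
def Phi (G : Plant n p q m) (r : ℝ) (f : ℝ → Fin d → ℝ) (Pi : Matrix (Fin d) (Fin d) ℝ)
    (C₃ : Matrix (Fin m) (KerIx n p d) ℝ) (J : Supply q m)
    (Q : Matrix (StateIx n p) (KerIx n p d) ℝ) (R : Matrix (KerIx n p d) (KerIx n p d) ℝ)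
    (S U : Matrix (StateIx n p) (StateIx n p) ℝ) :
    Matrix (BlockIx n p d q m) (BlockIx n p d q m) ℝ :=
  Sy (colQR q m Q R * rowF q m r f Pi)
    + dsum (S + r • U) (dsum (-S) (dsum (-((1 : Matrix (Fin d) (Fin d) ℝ) ⊗ₖ U))
        (dsum (-J.J₃) J.J₁)))
    + Sy (colJ n p d J * bigSigma G C₃)

/-- The matrix `Φ̂ = Φ + Sy(𝐏ᵀ (𝐀 + 𝐁 𝐊))`. -/
def PhiHat (G : Plant n p q m) (K : Gains n p d) (r : ℝ) (f : ℝ → Fin d → ℝ)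
    (Pi : Matrix (Fin d) (Fin d) ℝ) (C₃ : Matrix (Fin m) (KerIx n p d) ℝ) (J : Supply q m)
    (P : Matrix (StateIx n p) (StateIx n p) ℝ)
    (Q : Matrix (StateIx n p) (KerIx n p d) ℝ) (R : Matrix (KerIx n p d) (KerIx n p d) ℝ)
    (S U : Matrix (StateIx n p) (StateIx n p) ℝ) :
    Matrix (BlockIx n p d q m) (BlockIx n p d q m) ℝ :=
  Phi G r f Pi C₃ J Q R S U + Sy ((bigP q m P Q)ᵀ * (bigA d G + bigB n p * bigK q m K))

end ClosedLoop

/-! ### Counting the decision variables -/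

/-- The space of symmetric matrices. -/
def symMatrices (ι : Type) : Submodule ℝ (Matrix ι ι ℝ) where
  carrier := {X | Xᵀ = X}
  add_mem' := by
    intro a b ha hb
    simp only [mem_ofPred_eq] at ha hb ⊢
    rw [Matrix.transpose_add, ha, hb]
  zero_mem' := by simp
  smul_mem' := by
    intro c a ha
    simp only [mem_ofPred_eq] at ha ⊢
    rw [Matrix.transpose_smul, ha]

/-- The number of scalar unknowns in `P, Q, R, S, U, [K₁ K₂ K₃]`: the dimension of the space
of these tuples. -/
def numDecisionVars (n p d : ℕ) : ℕ :=
  Module.finrank ℝ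
    (symMatrices (StateIx n p) × Matrix (StateIx n p) (KerIx n p d) ℝ ×
      symMatrices (KerIx n p d) × symMatrices (StateIx n p) × symMatrices (StateIx n p) ×
      Matrix (Fin p) (StateIx n p ⊕ (StateIx n p ⊕ KerIx n p d)) ℝ)

end InputDelay

end

open InputDelay

namespace InputDelay

/-! ### Distributed-delay integrals with an exponential kernel -/

/-! Write x for the closed-loop state, g = √F f for the normalized kernel and m(t) = ∫ (g(τ) ⊗ I)
x(t+τ) dτ for its moments. The storage functional is a quadratic form in (x(t), m(t)) with blocks P,
Q, R, plus the integral of xᵀSx + (τ+r) xᵀUx over the delay window.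

Two properties of the kernel carry the argument. Since f solves a linear equation, the moments
satisfy the ordinary differential equation m' = F(0)x(t) − F(−r)x(t−r) − Π̂m, so the derivative of
the storage is a quadratic form in x(t), x(t−r), m and x'(t), minus ∫ xᵀUx (`hasDerivAt_storage`).
Since g is orthonormal in L²(−r,0), Bessel's inequality gives mᵀ(I ⊗ V)m ≤ ∫ xᵀVx for every V ⪰ 0
(`moment_dotProduct_kronecker_le`).

For V = U, Bessel replaces the remaining integral by a quadratic form in m. After the Schur
complement variable y = −J₁⁻¹J̃z is inserted, what remains is exactly the quadratic form of `PhiHat`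
at (x(t), x(t−r), m, w, y) (`exists_dotProduct_PhiHat_mulVec_eq`). Its negative definiteness yields
the dissipation inequality, and strictness leaves a decay −β(|x(t)|² + ∫|x|²)
(`IsFeasible.exists_decay`).

For V = S, Bessel turns the block condition with R + I ⊗ S into a lower bound ε|x(t)|² on the
storage; for V = I it gives an upper bound C(|x(t)|² + ∫|x|²). When w = 0 the supply rate is
nonpositive because J₁⁻¹ ≺ 0, so the storage V satisfies V' ≤ −(β/C)V almost everywhere. Grönwall's
inequality for absolutely continuous functions gives exponential stability, and this implies uniform
asymptotic stability. The count of variables uses that symmetric N × N matrices form a space of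
dimension N(N+1)/2. -/

/-- A solution of the linear equation `g' = L g` on `[-r,0]` is given by the exponential. -/
lemma eq_exp_apply_of_hasDerivWithinAt {E : Type*} [NormedAddCommGroup E] [NormedSpace ℝ E]
    [CompleteSpace E] {L : E →L[ℝ] E} {g : ℝ → E} {a b : ℝ}
    (hg : ∀ τ ∈ Icc a b, HasDerivWithinAt g (L (g τ)) (Icc a b) τ) :
    ∃ c : E, ∀ τ ∈ Icc a b, g τ = NormedSpace.exp (τ • L) c := by
  let : NormedAlgebra ℚ (E →L[ℝ] E) := NormedAlgebra.restrictScalars ℚ ℝ (E →L[ℝ] E)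
  -- Variation of constants: exp(−τL) g(τ) has zero derivative, so it keeps its value at a.
  have key : ∀ τ ∈ Icc a b, HasDerivWithinAt
      (fun s => NormedSpace.exp (s • (-L)) (g s)) 0 (Icc a b) τ := by
    intro τ hτ
    have h := (hasDerivAt_exp_smul_const (𝕂 := ℝ) (-L) τ).hasDerivWithinAt (s := Icc a b)
      |>.clm_apply (hg τ hτ)
    convert! h using 1
    simp
  refine ⟨NormedSpace.exp (a • (-L)) (g a), fun τ hτ => ?_⟩
  have hc := constant_of_has_deriv_right_zero (fun s hs => (key s hs).continuousWithinAt)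
    (fun s hs => (key s ⟨hs.1, hs.2.le⟩).mono_of_mem_nhdsWithin
      (Icc_mem_nhdsGE_of_mem hs)) τ hτ
  rw [← hc, ← mul_apply_eq_comp, ← NormedSpace.exp_add_of_commute]
  · simp
  · exact (((Commute.refl L).neg_right).smul_left τ).smul_right τ

/-- As y is only continuous, differentiating under the integral is not available. Writing g(τ) =
exp(τL)c and substituting s = t+τ turns the integral into exp(−tL) ∫_{t−r}^t y(s) exp(sL)c ds, where
t occurs only in a smooth factor and in the limits; the product rule then applies. -/
lemma hasDerivAt_integral_smul_translate {E : Type*} [NormedAddCommGroup E] [NormedSpace ℝ E]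
    [CompleteSpace E] {L : E →L[ℝ] E} {g : ℝ → E} {r : ℝ} (hr : 0 ≤ r)
    (hg : ∀ τ ∈ Icc (-r) 0, HasDerivWithinAt g (L (g τ)) (Icc (-r) 0) τ)
    {y : ℝ → ℝ} (hy : Continuous y) (t : ℝ) :
    HasDerivAt (fun t => ∫ τ in (-r)..0, y (t + τ) • g τ)
      (y t • g 0 - y (t - r) • g (-r) - L (∫ τ in (-r)..0, y (t + τ) • g τ)) t := by
  let : NormedAlgebra ℚ (E →L[ℝ] E) := NormedAlgebra.restrictScalars ℚ ℝ (E →L[ℝ] E)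
  obtain ⟨c, hc⟩ := eq_exp_apply_of_hasDerivWithinAt hg
  set e : ℝ → E →L[ℝ] E := fun s => NormedSpace.exp (s • L) with he
  have hecont : Continuous e := NormedSpace.exp_continuous.comp (by fun_prop)
  have hadd : ∀ s s' v, e (s + s') v = e s (e s' v) := fun s s' v => by
    rw [← mul_apply_eq_comp, ← NormedSpace.exp_add_of_commute, ← add_smul]
    exact ((Commute.refl L).smul_left s).smul_right s'
  have hk : Continuous fun s => y s • e s c := by fun_prop
  have hform : ∀ t, ∫ τ in (-r)..0, y (t + τ) • g τ
      = e (-t) (∫ s in (t - r)..t, y s • e s c) := by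
    intro t
    rw [← ContinuousLinearMap.intervalIntegral_comp_comm _ (hk.intervalIntegrable _ _)]
    have h := intervalIntegral.integral_comp_add_left (a := -r) (b := 0)
      (fun s => e (-t) (y s • e s c)) t
    rw [add_zero, ← sub_eq_add_neg] at h
    rw [← h]
    refine intervalIntegral.integral_congr fun τ hτ => ?_
    rw [uIcc_of_le (by linarith)] at hτ
    simp only [map_smul]
    rw [← hadd, neg_add_cancel_left, hc τ hτ]
  have hint : HasDerivAt (fun t => ∫ s in (t - r)..t, y s • e s c)
      (y t • e t c - y (t - r) • e (t - r) c) t := by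
    have h0 : ∀ t, HasDerivAt (fun t => ∫ s in (0 : ℝ)..t, y s • e s c) (y t • e t c) t :=
      fun t => hk.integral_hasStrictDerivAt 0 t |>.hasDerivAt
    have h1 := (h0 t).sub ((h0 (t - r)).comp_sub_const t r)
    refine h1.congr_of_eventuallyEq (Filter.Eventually.of_forall fun s => ?_)
    exact (intervalIntegral.integral_interval_sub_left (hk.intervalIntegrable _ _)
      (hk.intervalIntegrable _ _)).symm
  have hexp : HasDerivAt (fun t => e (-t)) (-(L * e (-t))) t := by
    have h := (hasDerivAt_exp_smul_const' (𝕂 := ℝ) L (-t)).scomp t (hasDerivAt_neg t)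
    simpa [Function.comp_def, he] using h
  have h := hexp.clm_apply hint
  simp_rw [hform]
  convert! h using 1
  have e0 : e (-t) (e t c) = g 0 := by
    rw [← hadd, neg_add_cancel, hc 0 ⟨by linarith, le_rfl⟩]
  have er : e (-t) (e (t - r) c) = g (-r) := by
    rw [← hadd, hc (-r) ⟨le_rfl, by linarith⟩]
    simp only [he]; congr 3; ring
  simp only [map_sub, map_smul, e0, er, neg_apply,
    mul_apply_eq_comp]
  abel

lemma hasDerivAt_integral_kernel_mul {κ : Type*} [Fintype κ] {Θ : Matrix κ κ ℝ}
    {g : ℝ → κ → ℝ} {r : ℝ} (hr : 0 ≤ r)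
    (hg : ∀ τ ∈ Icc (-r) 0, HasDerivWithinAt g (Θ *ᵥ g τ) (Icc (-r) 0) τ)
    {y : ℝ → ℝ} (hy : Continuous y) (i : κ) (t : ℝ) :
    HasDerivAt (fun t => ∫ τ in (-r)..0, g τ i * y (t + τ))
      (g 0 i * y t - g (-r) i * y (t - r)
        - ∑ k, Θ i k * ∫ τ in (-r)..0, g τ k * y (t + τ)) t := by
  have hcont : ContinuousOn g (Icc (-r) 0) := fun τ hτ => (hg τ hτ).continuousWithinAt
  have hcomp : ∀ (k : κ) t, (∫ τ in (-r)..0, y (t + τ) • g τ) k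
      = ∫ τ in (-r)..0, g τ k * y (t + τ) := by
    intro k t
    have h := ContinuousLinearMap.intervalIntegral_comp_comm (μ := volume) (a := -r) (b := 0)
      (ContinuousLinearMap.proj (R := ℝ) (φ := fun _ : κ => ℝ) k)
      (f := fun τ => y (t + τ) • g τ) (by
        apply ContinuousOn.intervalIntegrable
        rw [uIcc_of_le (by linarith)]
        exact (by fun_prop : Continuous fun τ => y (t + τ)).continuousOn.smul hcont)
    simp only [ContinuousLinearMap.proj_apply, Pi.smul_apply, smul_eq_mul] at h
    rw [← h]
    simp only [mul_comm]
  have h := hasDerivAt_integral_smul_translate (L := LinearMap.toContinuousLinearMap Θ.mulVecLin)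
    hr (by simpa using hg) hy t
  have h' := (hasDerivAt_pi.1 h) i
  simp only [hcomp] at h'
  convert! h' using 1
  simp [Matrix.mulVec, dotProduct, hcomp, mul_comm (y _)]

lemma absolutelyContinuousOnInterval_of_hasDerivAt {f f' : ℝ → ℝ} (hf : ∀ t, HasDerivAt f (f' t) t)
    (hf' : Continuous f') (a b : ℝ) : AbsolutelyContinuousOnInterval f a b := by
  obtain ⟨C, hC⟩ := (isCompact_uIcc (a := a) (b := b)).exists_bound_of_continuousOn
    hf'.continuousOn
  refine LipschitzOnWith.absolutelyContinuousOnInterval (K := C.toNNReal) ?_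
  refine (convex_uIcc a b).lipschitzOnWith_of_nnnorm_hasDerivWithin_le
    (fun x _ => (hf x).hasDerivWithinAt) fun x hx => ?_
  rw [← NNReal.coe_le_coe, coe_nnnorm]
  exact (hC x hx).trans (Real.le_coe_toNNReal C)

/-- The pair (τ+r, 1) solves a linear equation with a nilpotent matrix, so this is a case of the
kernel formula. The ramp is 0 at −r and r at 0, hence y₂ contributes only r·y₂(t) and the integral.
-/
lemma hasDerivAt_integral_add_ramp_mul {r : ℝ} (hr : 0 ≤ r) {y₁ y₂ : ℝ → ℝ}
    (h₁ : Continuous y₁) (h₂ : Continuous y₂) (t : ℝ) :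
    HasDerivAt (fun t => ∫ τ in (-r)..0, (y₁ (t + τ) + (τ + r) * y₂ (t + τ)))
      (y₁ t + r * y₂ t - y₁ (t - r) - ∫ τ in (-r)..0, y₂ (t + τ)) t := by
  have hg : ∀ τ ∈ Icc (-r) 0, HasDerivWithinAt (fun τ => ![τ + r, 1])
      ((!![0, 1; 0, 0] : Matrix (Fin 2) (Fin 2) ℝ) *ᵥ ![τ + r, 1]) (Icc (-r) 0) τ := by
    intro τ _
    apply HasDerivAt.hasDerivWithinAt
    rw [hasDerivAt_pi]
    intro i
    fin_cases i
    · simpa [Matrix.mulVec, dotProduct] using (hasDerivAt_id τ).add_const r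
    · simpa [Matrix.mulVec, dotProduct] using hasDerivAt_const τ (1 : ℝ)
  have d₁ := hasDerivAt_integral_kernel_mul hr hg h₁ 1 t
  have d₂ := hasDerivAt_integral_kernel_mul hr hg h₂ 0 t
  simp only [Fin.sum_univ_two, Matrix.cons_val_zero, Matrix.cons_val_one, Matrix.of_apply,
    zero_mul, one_mul, zero_add, add_zero, neg_add_cancel, sub_zero] at d₁ d₂
  have h := d₁.add d₂
  refine (h.congr_of_eventuallyEq (Filter.Eventually.of_forall fun s => ?_)).congr_deriv (by ring)
  exact intervalIntegral.integral_add
    ((by fun_prop : Continuous fun τ => y₁ (s + τ)).intervalIntegrable _ _)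
    ((by fun_prop : Continuous fun τ => (τ + r) * y₂ (s + τ)).intervalIntegrable _ _)

/-! ### Quadratic forms -/

lemma dotProduct_mulVec_eq_sum {ι : Type*} [Fintype ι] (M : Matrix ι ι ℝ) (z : ι → ℝ) :
    z ⬝ᵥ (M *ᵥ z) = ∑ i, ∑ j, M i j * (z i * z j) := by
  simp only [dotProduct, Matrix.mulVec, Finset.mul_sum]
  exact Finset.sum_congr rfl fun i _ => Finset.sum_congr rfl fun j _ => by ring

/-- The constant is the minimum of the form on the compact unit sphere, extended by homogeneity.
With an empty index type the sphere is empty, so that case is split off. -/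
lemma exists_pos_mul_dotProduct_le {ι : Type*} [Fintype ι] {M : Matrix ι ι ℝ} (hM : M.PosDef) :
    ∃ ε > 0, ∀ z : ι → ℝ, ε * (z ⬝ᵥ z) ≤ z ⬝ᵥ (M *ᵥ z) := by
  have hpos : ∀ z : ι → ℝ, z ≠ 0 → 0 < z ⬝ᵥ (M *ᵥ z) := fun z hz => by
    simpa using hM.dotProduct_mulVec_pos hz
  have hnorm : ∀ z : EuclideanSpace ℝ ι, z.ofLp ⬝ᵥ z.ofLp = ‖z‖ ^ 2 := fun z => by
    rw [EuclideanSpace.real_norm_sq_eq]; simp [dotProduct, sq]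
  rcases isEmpty_or_nonempty ι with hι | hι
  · exact ⟨1, one_pos, fun z => by simp [dotProduct]⟩
  have hc : Continuous fun z : EuclideanSpace ℝ ι => z.ofLp ⬝ᵥ (M *ᵥ z.ofLp) := by
    simp only [dotProduct_mulVec_eq_sum]; fun_prop
  obtain ⟨z₀, hz₀, hmin⟩ := (isCompact_sphere (0 : EuclideanSpace ℝ ι) 1).exists_isMinOn
    (NormedSpace.sphere_nonempty.2 zero_le_one) hc.continuousOn
  refine ⟨_, hpos z₀.ofLp fun h => ?_, fun z => ?_⟩
  · have : z₀ = 0 := by ext i; exact congrFun h i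
    simp [this] at hz₀
  rcases eq_or_ne z 0 with rfl | hz
  · simp
  set w : EuclideanSpace ℝ ι := WithLp.toLp 2 z with hw
  have hw0 : ‖w‖ ≠ 0 := by
    rw [norm_ne_zero_iff]; intro h; exact hz (by simpa [hw] using h)
  have h := hmin (a := ‖w‖⁻¹ • w) (by simp [norm_smul, hw0])
  simp only [mem_ofPred_eq, WithLp.ofLp_smul, Matrix.mulVec_smul, dotProduct_smul,
    smul_dotProduct, smul_eq_mul] at h
  rw [show z = w.ofLp from rfl, hnorm]
  have hw2 : 0 < ‖w‖ ^ 2 := by positivity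
  calc _ ≤ (‖w‖⁻¹ * (‖w‖⁻¹ * (w.ofLp ⬝ᵥ M *ᵥ w.ofLp))) * ‖w‖ ^ 2 := by gcongr
    _ = _ := by field_simp

lemma exists_pos_dotProduct_le_mul {ι : Type*} [Fintype ι] (M : Matrix ι ι ℝ) :
    ∃ C > 0, ∀ z : ι → ℝ, z ⬝ᵥ (M *ᵥ z) ≤ C * (z ⬝ᵥ z) := by
  -- The entry sum is already a bound; the added 1 makes the constant positive even when M = 0.
  refine ⟨1 + ∑ i, ∑ j, |M i j|, by positivity, fun z => ?_⟩
  have hz : ∀ i, z i ^ 2 ≤ z ⬝ᵥ z := fun i => by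
    rw [sq]
    exact Finset.single_le_sum (f := fun i => z i * z i) (fun j _ => mul_self_nonneg _)
      (Finset.mem_univ i)
  have h0 : 0 ≤ z ⬝ᵥ z := Finset.sum_nonneg fun j _ => mul_self_nonneg _
  rw [dotProduct_mulVec_eq_sum, add_mul, Finset.sum_mul]
  refine le_add_of_nonneg_of_le (by linarith) (Finset.sum_le_sum fun i _ => ?_)
  rw [Finset.sum_mul]
  refine Finset.sum_le_sum fun j _ => ?_
  have h1 : |z i * z j| ≤ z ⬝ᵥ z := by
    rw [abs_le]
    constructor <;> nlinarith [hz i, hz j, sq_nonneg (z i + z j), sq_nonneg (z i - z j)]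
  calc M i j * (z i * z j) ≤ |M i j| * |z i * z j| := by rw [← abs_mul]; exact le_abs_self _
    _ ≤ _ := by gcongr

lemma kronecker_one_dotProduct_mulVec {ι κ : Type*} [Fintype ι] [Fintype κ] [DecidableEq κ]
    (U : Matrix ι ι ℝ) (z : κ × ι → ℝ) :
    z ⬝ᵥ (((1 : Matrix κ κ ℝ) ⊗ₖ U) *ᵥ z)
      = ∑ i, ∑ j, U i j * ∑ k, z (k, i) * z (k, j) := by
  have h : ∀ k i, (((1 : Matrix κ κ ℝ) ⊗ₖ U) *ᵥ z) (k, i) = ∑ j, U i j * z (k, j) := by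
    intro k i
    simp [Matrix.mulVec, dotProduct, Fintype.sum_prod_type, Matrix.one_apply]
  simp only [dotProduct, Fintype.sum_prod_type, h]
  rw [Finset.sum_comm]
  refine Finset.sum_congr rfl fun i _ => ?_
  simp only [Finset.mul_sum]
  rw [Finset.sum_comm]
  exact Finset.sum_congr rfl fun j _ => Finset.sum_congr rfl fun k _ => by ring

lemma kronecker_one_mulVec {ι κ : Type*} [Fintype ι] [Fintype κ] [DecidableEq ι]
    (Θ : Matrix κ κ ℝ) (z : κ × ι → ℝ) (i : κ) (j : ι) :
    ((Θ ⊗ₖ (1 : Matrix ι ι ℝ)) *ᵥ z) (i, j) = ∑ k, Θ i k * z (k, j) := by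
  simp [Matrix.mulVec, dotProduct, Fintype.sum_prod_type, Matrix.one_apply]

/-! ### Moments and Bessel's inequality -/

/-- The moments `∫_{-r}^0 (g(τ) ⊗ I) x(t + τ) dτ`. -/
noncomputable def moment {ι κ : Type*} (r : ℝ) (g : ℝ → κ → ℝ) (x : ℝ → ι → ℝ) (t : ℝ) :
    κ × ι → ℝ :=
  fun k => ∫ τ in (-r)..0, g τ k.1 * x (t + τ) k.2

/-- Orthonormality of the family `g` in `L²(-r,0)`. -/
def IsOrthonormal {κ : Type*} [DecidableEq κ] (r : ℝ) (g : ℝ → κ → ℝ) : Prop :=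
  ∀ i j, ∫ τ in (-r)..0, g τ i * g τ j = (1 : Matrix κ κ ℝ) i j

/-- On expansion, both cross terms and, by orthonormality, the double sum are equal to ∑ aₖbₖ; with
signs −, −, + a single −∑ aₖbₖ survives. -/
lemma integral_sub_projection_mul {κ : Type*} [Fintype κ] [DecidableEq κ] {r : ℝ} (hr : 0 ≤ r)
    {g : ℝ → κ → ℝ} (hg : ContinuousOn g (Icc (-r) 0)) (hon : IsOrthonormal r g)
    {y₁ y₂ : ℝ → ℝ} (h₁ : Continuous y₁) (h₂ : Continuous y₂) {a b : κ → ℝ}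
    (ha : ∀ k, a k = ∫ τ in (-r)..0, g τ k * y₁ τ)
    (hb : ∀ k, b k = ∫ τ in (-r)..0, g τ k * y₂ τ) :
    ∫ τ in (-r)..0, (y₁ τ - ∑ k, g τ k * a k) * (y₂ τ - ∑ k, g τ k * b k)
      = (∫ τ in (-r)..0, y₁ τ * y₂ τ) - ∑ k, a k * b k := by
  have hgk : ∀ k, ContinuousOn (fun τ => g τ k) (uIcc (-r) 0) := fun k => by
    rw [uIcc_of_le (by linarith)]; exact continuousOn_pi.1 hg k
  have i0 : IntervalIntegrable (fun τ => y₁ τ * y₂ τ) volume (-r) 0 :=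
    (h₁.mul h₂).intervalIntegrable _ _
  have i1 : ∀ k, IntervalIntegrable (fun τ => b k * (g τ k * y₁ τ)) volume (-r) 0 := fun k =>
    (((hgk k).mul h₁.continuousOn).const_mul _).intervalIntegrable
  have i2 : ∀ k, IntervalIntegrable (fun τ => a k * (g τ k * y₂ τ)) volume (-r) 0 := fun k =>
    (((hgk k).mul h₂.continuousOn).const_mul _).intervalIntegrable
  have i3 : ∀ k l, IntervalIntegrable (fun τ => a k * b l * (g τ k * g τ l)) volume (-r) 0 :=
    fun k l => (((hgk k).mul (hgk l)).const_mul _).intervalIntegrable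
  have e : ∀ τ, (y₁ τ - ∑ k, g τ k * a k) * (y₂ τ - ∑ k, g τ k * b k)
      = y₁ τ * y₂ τ - (∑ k, b k * (g τ k * y₁ τ)) - (∑ k, a k * (g τ k * y₂ τ))
        + ∑ k, ∑ l, a k * b l * (g τ k * g τ l) := by
    intro τ
    have s1 : ∑ k, b k * (g τ k * y₁ τ) = y₁ τ * ∑ k, g τ k * b k := by
      rw [Finset.mul_sum]; exact Finset.sum_congr rfl fun k _ => by ring
    have s2 : ∑ k, a k * (g τ k * y₂ τ) = (∑ k, g τ k * a k) * y₂ τ := by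
      rw [Finset.sum_mul]; exact Finset.sum_congr rfl fun k _ => by ring
    have s3 : ∑ k, ∑ l, a k * b l * (g τ k * g τ l)
        = (∑ k, g τ k * a k) * ∑ k, g τ k * b k := by
      rw [Finset.sum_mul_sum]
      exact Finset.sum_congr rfl fun k _ => Finset.sum_congr rfl fun l _ => by ring
    rw [s1, s2, s3]; ring
  have j1 := IntervalIntegrable.sum Finset.univ fun k _ => i1 k
  have j2 := IntervalIntegrable.sum Finset.univ fun k _ => i2 k
  have j3 := IntervalIntegrable.sum Finset.univ fun k _ =>
    IntervalIntegrable.sum Finset.univ fun l _ => i3 k l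
  simp only [Finset.sum_fn] at j1 j2 j3
  simp only [e]
  rw [intervalIntegral.integral_add ((i0.sub j1).sub j2) j3,
    intervalIntegral.integral_sub (i0.sub j1) j2, intervalIntegral.integral_sub i0 j1,
    intervalIntegral.integral_finsetSum fun k _ => i1 k,
    intervalIntegral.integral_finsetSum fun k _ => i2 k,
    intervalIntegral.integral_finsetSum fun k _ => by
      simpa only [Finset.sum_fn] using IntervalIntegrable.sum Finset.univ fun l _ => i3 k l]
  simp only [intervalIntegral.integral_const_mul, ← ha, ← hb]
  have s : ∀ k, ∫ τ in (-r)..0, ∑ l, a k * b l * (g τ k * g τ l) = a k * b k := by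
    intro k
    rw [intervalIntegral.integral_finsetSum fun l _ => i3 k l]
    simp [intervalIntegral.integral_const_mul, hon k _, Matrix.one_apply]
  simp only [s, mul_comm (b _)]
  ring

/-- Matrix form of Bessel's inequality: the difference of the two sides is ∫ qᵀUq, where q is the
remainder of x(t+·) after orthogonal projection onto the span of g. -/
lemma moment_dotProduct_kronecker_le {ι κ : Type*} [Fintype ι] [Fintype κ] [DecidableEq κ]
    {r : ℝ} (hr : 0 ≤ r) {g : ℝ → κ → ℝ} (hg : ContinuousOn g (Icc (-r) 0))
    (hon : IsOrthonormal r g) {U : Matrix ι ι ℝ} (hU : U.PosSemidef) {x : ℝ → ι → ℝ}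
    (hx : Continuous x) (t : ℝ) :
    moment r g x t ⬝ᵥ (((1 : Matrix κ κ ℝ) ⊗ₖ U) *ᵥ moment r g x t)
      ≤ ∫ τ in (-r)..0, x (t + τ) ⬝ᵥ (U *ᵥ x (t + τ)) := by
  set m := moment r g x t with hm
  have hgk : ∀ k, ContinuousOn (fun τ => g τ k) (uIcc (-r) 0) := fun k => by
    rw [uIcc_of_le (by linarith)]; exact continuousOn_pi.1 hg k
  have hxi : ∀ i, Continuous fun τ => x (t + τ) i := fun i => by fun_prop
  set q : ℝ → ι → ℝ := fun τ i => x (t + τ) i - ∑ k, g τ k * m (k, i) with hq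
  have hqi : ∀ i, ContinuousOn (fun τ => q τ i) (uIcc (-r) 0) := fun i =>
    (hxi i).continuousOn.sub (continuousOn_finsetSum _ fun k _ => (hgk k).mul_const _)
  have h0 : 0 ≤ ∫ τ in (-r)..0, q τ ⬝ᵥ (U *ᵥ q τ) :=
    intervalIntegral.integral_nonneg (by linarith) fun τ _ => by
      simpa using hU.dotProduct_mulVec_nonneg (q τ)
  have hsum : ∀ z : ℝ → ι → ℝ, (∀ i, ContinuousOn (fun τ => z τ i) (uIcc (-r) 0)) →
      ∫ τ in (-r)..0, z τ ⬝ᵥ (U *ᵥ z τ)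
        = ∑ i, ∑ j, U i j * ∫ τ in (-r)..0, z τ i * z τ j := by
    intro z hz
    have hi : ∀ i j, IntervalIntegrable (fun τ => U i j * (z τ i * z τ j)) volume (-r) 0 :=
      fun i j => (((hz i).mul (hz j)).const_mul _).intervalIntegrable
    simp only [dotProduct_mulVec_eq_sum]
    rw [intervalIntegral.integral_finsetSum fun i _ => by
      simpa only [Finset.sum_fn] using IntervalIntegrable.sum Finset.univ fun j _ => hi i j]
    refine Finset.sum_congr rfl fun i _ => ?_
    rw [intervalIntegral.integral_finsetSum fun j _ => hi i j]
    simp only [intervalIntegral.integral_const_mul]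
  rw [hsum q hqi] at h0
  rw [hsum (fun τ => x (t + τ)) fun i => (hxi i).continuousOn, kronecker_one_dotProduct_mulVec]
  rw [← sub_nonneg]
  convert! h0 using 1
  simp only [← Finset.sum_sub_distrib, ← mul_sub]
  refine Finset.sum_congr rfl fun i _ => Finset.sum_congr rfl fun j _ => ?_
  rw [integral_sub_projection_mul hr hg hon (hxi i) (hxi j) (a := fun k => m (k, i))
    (b := fun k => m (k, j)) (fun k => rfl) (fun k => rfl)]

/-! ### The normalized kernel -/

section Kernel

variable {d : ℕ} {r : ℝ} {f : ℝ → Fin d → ℝ}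

lemma sqrtF_transpose : (sqrtF r f)ᵀ = sqrtF r f := by
  have h := (CFC.sqrt_nonneg (gram r f)⁻¹).isSelfAdjoint
  rw [← Matrix.conjTranspose_eq_transpose_of_trivial]
  exact h

lemma sqrt_gram_mul_sqrtF (hF : (gram r f).PosDef) : CFC.sqrt (gram r f) * sqrtF r f = 1 := by
  have hsq := CFC.sqrt_mul_sqrt_self (gram r f) hF.posSemidef.nonneg
  have hunit : IsUnit (CFC.sqrt (gram r f)) :=
    isUnit_of_mul_isUnit_left (hsq ▸ hF.isUnit)
  have hdet := (Matrix.isUnit_iff_isUnit_det _).1 hunit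
  have hpsd : (CFC.sqrt (gram r f)).PosSemidef :=
    Matrix.nonneg_iff_posSemidef.1 (CFC.sqrt_nonneg _)
  -- The root of the inverse is the inverse of the root, by uniqueness of the positive semidefinite
  -- square root.
  have : sqrtF r f = (CFC.sqrt (gram r f))⁻¹ := by
    refine CFC.sqrt_unique ?_ hpsd.inv.nonneg
    rw [← Matrix.mul_inv_rev, hsq]
  rw [this, Matrix.mul_nonsing_inv _ hdet]

lemma sqrtF_mul_gram_mul_sqrtF (hF : (gram r f).PosDef) :
    sqrtF r f * gram r f * sqrtF r f = 1 := by
  have h1 := sqrt_gram_mul_sqrtF hF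
  have h2 := mul_eq_one_comm.1 h1
  have hsq := CFC.sqrt_mul_sqrt_self (gram r f) hF.posSemidef.nonneg
  rw [← hsq, ← mul_assoc, h2, one_mul, h1]

/-- The Gram matrix of √F f is √F F⁻¹ √F = I, which is the purpose of the normalization. -/
lemma isOrthonormal_sqrtF_mulVec (hf : ContinuousOn f (Icc (-r) 0)) (hr : 0 ≤ r)
    (hF : (gram r f).PosDef) :
    IsOrthonormal r fun τ => sqrtF r f *ᵥ f τ := by
  intro i j
  have hfk : ∀ k, ContinuousOn (fun τ => f τ k) (uIcc (-r) 0) := fun k => by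
    rw [uIcc_of_le (by linarith)]; exact continuousOn_pi.1 hf k
  have hi : ∀ k l, IntervalIntegrable
      (fun τ => sqrtF r f i k * sqrtF r f j l * (f τ k * f τ l)) volume (-r) 0 :=
    fun k l => (((hfk k).mul (hfk l)).const_mul _).intervalIntegrable
  have e : ∀ τ, (sqrtF r f *ᵥ f τ) i * (sqrtF r f *ᵥ f τ) j
      = ∑ k, ∑ l, sqrtF r f i k * sqrtF r f j l * (f τ k * f τ l) := by
    intro τ
    simp only [Matrix.mulVec, dotProduct, Finset.sum_mul_sum]
    exact Finset.sum_congr rfl fun k _ => Finset.sum_congr rfl fun l _ => by ring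
  simp only [e]
  rw [intervalIntegral.integral_finsetSum fun k _ => by
      simpa only [Finset.sum_fn] using IntervalIntegrable.sum Finset.univ fun l _ => hi k l,
    ← sqrtF_mul_gram_mul_sqrtF hF, mul_assoc, Matrix.mul_apply]
  refine Finset.sum_congr rfl fun k _ => ?_
  rw [intervalIntegral.integral_finsetSum fun l _ => hi k l, Matrix.mul_apply, Finset.mul_sum]
  refine Finset.sum_congr rfl fun l _ => ?_
  have : sqrtF r f l j = sqrtF r f j l := congrFun (congrFun sqrtF_transpose j) l
  rw [intervalIntegral.integral_const_mul, this]
  simp only [gram, Matrix.of_apply]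
  ring

end Kernel

/-- Conjugation: √F Π f = (√F Π √(F⁻¹)) (√F f), so the normalized kernel again solves a linear
equation, with the matrix underlying Π̂. -/
lemma hasDerivWithinAt_sqrtF_mulVec {d : ℕ} {r : ℝ} {f : ℝ → Fin d → ℝ}
    {Pi : Matrix (Fin d) (Fin d) ℝ} (hF : (gram r f).PosDef)
    (hf : ∀ τ ∈ Icc (-r) 0, HasDerivWithinAt f (Pi *ᵥ f τ) (Icc (-r) 0) τ) :
    ∀ τ ∈ Icc (-r) 0, HasDerivWithinAt (fun τ => sqrtF r f *ᵥ f τ)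
      ((sqrtF r f * Pi * CFC.sqrt (gram r f)) *ᵥ (sqrtF r f *ᵥ f τ)) (Icc (-r) 0) τ := by
  intro τ hτ
  have h := (LinearMap.toContinuousLinearMap (sqrtF r f).mulVecLin).hasFDerivAt
    |>.comp_hasDerivWithinAt τ (hf τ hτ)
  convert! h using 1
  simp only [LinearMap.coe_toContinuousLinearMap', Matrix.mulVecLin_apply, Matrix.mulVec_mulVec]
  rw [mul_assoc, mul_assoc, sqrt_gram_mul_sqrtF hF, mul_one]

lemma kernelF_mulVec (n p : ℕ) {d : ℕ} (r : ℝ) (f : ℝ → Fin d → ℝ) (τ : ℝ)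
    (x : StateIx n p → ℝ) :
    kernelF n p r f τ *ᵥ x = fun k => (sqrtF r f *ᵥ f τ) k.1 * x k.2 := by
  ext k
  simp [kernelF, Matrix.mulVec, dotProduct, Matrix.one_apply]

/-! ### Counting the decision variables -/

/-- A symmetric matrix is determined by its entries on and above the diagonal. -/
def symMatricesEquiv (ι : Type) [LinearOrder ι] :
    symMatrices ι ≃ₗ[ℝ] ({ij : ι × ι // ij.1 ≤ ij.2} → ℝ) where
  toFun X := fun ij => X.1 ij.1.1 ij.1.2
  map_add' _ _ := rfl
  map_smul' _ _ := rfl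
  invFun v := ⟨Matrix.of fun i j => v ⟨(min i j, max i j), min_le_max⟩, by
    change Matrix.transpose _ = _
    ext i j
    simp only [Matrix.transpose_apply, Matrix.of_apply, min_comm i j, max_comm i j]⟩
  left_inv X := by
    have hX : (X.1)ᵀ = X.1 := X.2
    ext i j
    rcases le_total i j with h | h
    · simp [h]
    · simp only [Matrix.of_apply, min_eq_right h, max_eq_left h]
      exact congrFun (congrFun hX i) j
  right_inv v := by
    ext ⟨⟨i, j⟩, h⟩
    have h' : i ≤ j := h
    simp [h']

/-- The sets {i ≤ j} and {j ≤ i} are equinumerous, cover all N² pairs and meet in the N diagonal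
ones. The order is borrowed from an enumeration of the index type. -/
lemma two_mul_finrank_symMatrices (ι : Type) [Fintype ι] :
    2 * Module.finrank ℝ (symMatrices ι) = Fintype.card ι * (Fintype.card ι + 1) := by
  classical
  let _ : LinearOrder ι := LinearOrder.lift' (Fintype.equivFin ι) (Fintype.equivFin ι).injective
  rw [(symMatricesEquiv ι).finrank_eq, Module.finrank_fintype_fun_eq_card, Fintype.card_subtype]
  have h1 : (Finset.univ.filter fun ij : ι × ι => ij.1 ≤ ij.2).card
      = (Finset.univ.filter fun ij : ι × ι => ij.2 ≤ ij.1).card :=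
    Finset.card_equiv (Equiv.prodComm ι ι) (by simp)
  have h2 := Finset.card_union_add_card_inter
    (Finset.univ.filter fun ij : ι × ι => ij.1 ≤ ij.2)
    (Finset.univ.filter fun ij : ι × ι => ij.2 ≤ ij.1)
  have h3 : (Finset.univ.filter fun ij : ι × ι => ij.1 ≤ ij.2)
      ∪ (Finset.univ.filter fun ij : ι × ι => ij.2 ≤ ij.1) = Finset.univ := by
    ext ij; simp [le_total]
  have h4 : (Finset.univ.filter fun ij : ι × ι => ij.1 ≤ ij.2)
      ∩ (Finset.univ.filter fun ij : ι × ι => ij.2 ≤ ij.1) = Finset.univ.diag := by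
    ext ij; simp [le_antisymm_iff]
  rw [h3, h4, Finset.diag_card, Finset.card_univ, Finset.card_univ, Fintype.card_prod] at h2
  linarith

lemma numDecisionVars_eq (n p d : ℕ) :
    (numDecisionVars n p d : ℝ) =
      (0.5 * (d : ℝ) ^ 2 + d + 1.5) * ((n + p : ℕ) : ℝ) ^ 2
        + (0.5 * d + p * d + 2 * p + 1.5) * ((n + p : ℕ) : ℝ) := by
  have h : numDecisionVars n p d = 3 * Module.finrank ℝ (symMatrices (StateIx n p))
      + Module.finrank ℝ (symMatrices (KerIx n p d)) + (n + p) * (d * (n + p))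
      + p * ((n + p) + ((n + p) + d * (n + p))) := by
    simp only [numDecisionVars, Module.finrank_prod, Module.finrank_matrix, Module.finrank_self,
      Fintype.card_sum, Fintype.card_prod, Fintype.card_fin, mul_one]
    ring
  have h1 := two_mul_finrank_symMatrices (StateIx n p)
  have h2 := two_mul_finrank_symMatrices (KerIx n p d)
  simp only [Fintype.card_sum, Fintype.card_prod, Fintype.card_fin] at h1 h2
  have h1' := congrArg (Nat.cast (R := ℝ)) h1
  have h2' := congrArg (Nat.cast (R := ℝ)) h2
  rw [h]
  push_cast at h1' h2' ⊢
  -- Three symmetric ν × ν unknowns (P, S, U) and one symmetric dν × dν unknown (R), each count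
  -- being half of N(N+1).
  linear_combination (3 / 2) * h1' + (1 / 2) * h2'

/-- Each of the seven monomials is at most d²ν², using p ≤ ν ≤ ν² and 1 ≤ d; the coefficients add up
to 8, so 9 is enough. -/
lemma numDecisionVars_le (n p d : ℕ) (hd : 1 ≤ d) :
    (numDecisionVars n p d : ℝ) ≤ 9 * ((d : ℝ) ^ 2 * ((n + p : ℕ) : ℝ) ^ 2) := by
  rw [numDecisionVars_eq]
  have hpν : (p : ℝ) ≤ ((n + p : ℕ) : ℝ) := by exact_mod_cast Nat.le_add_left p n
  have hνν : ((n + p : ℕ) : ℝ) ≤ ((n + p : ℕ) : ℝ) ^ 2 := by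
    exact_mod_cast Nat.le_self_pow two_ne_zero _
  have hd1 : (1 : ℝ) ≤ d := by exact_mod_cast hd
  set ν : ℝ := ((n + p : ℕ) : ℝ)
  have hν : 0 ≤ ν := Nat.cast_nonneg _
  have hp : (0 : ℝ) ≤ p := Nat.cast_nonneg _
  have hdd : (d : ℝ) ≤ (d : ℝ) ^ 2 := by nlinarith
  have hpν2 : p * ν ≤ ν ^ 2 := by nlinarith
  have a1 : d * ν ^ 2 ≤ d ^ 2 * ν ^ 2 := by gcongr
  have a2 : ν ^ 2 ≤ d ^ 2 * ν ^ 2 := le_mul_of_one_le_left (by positivity) (by linarith)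
  have a3 : d * ν ≤ d ^ 2 * ν ^ 2 := by gcongr
  have a4 : d * (p * ν) ≤ d ^ 2 * ν ^ 2 := by gcongr
  nlinarith

/-! ### The storage functional -/

section Storage

variable {ι κ : Type*} [Fintype ι] [Fintype κ]

lemma hasDerivAt_dotProduct {a b : ℝ → ι → ℝ} {a' b' : ι → ℝ} {t : ℝ}
    (ha : HasDerivAt a a' t) (hb : HasDerivAt b b' t) :
    HasDerivAt (fun t => a t ⬝ᵥ b t) (a' ⬝ᵥ b t + a t ⬝ᵥ b') t := by
  simp only [dotProduct, ← Finset.sum_add_distrib]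
  exact HasDerivAt.fun_sum fun i _ => (hasDerivAt_pi.1 ha i).mul (hasDerivAt_pi.1 hb i)

lemma hasDerivAt_mulVec {a : ℝ → ι → ℝ} {a' : ι → ℝ} {t : ℝ} (M : Matrix κ ι ℝ)
    (ha : HasDerivAt a a' t) : HasDerivAt (fun t => M *ᵥ a t) (M *ᵥ a') t :=
  (LinearMap.toContinuousLinearMap M.mulVecLin).hasFDerivAt.comp_hasDerivAt t ha

lemma absolutelyContinuousOnInterval_sum {α : Type*} {s : Finset α} {a : α → ℝ → ℝ} {b c : ℝ}
    (h : ∀ i ∈ s, AbsolutelyContinuousOnInterval (a i) b c) :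
    AbsolutelyContinuousOnInterval (fun t => ∑ i ∈ s, a i t) b c := by
  classical
  induction s using Finset.induction_on with
  | empty =>
    simpa using absolutelyContinuousOnInterval_of_hasDerivAt
      (fun t => hasDerivAt_const t (0 : ℝ)) continuous_const b c
  | insert i s hi ih =>
    simp only [Finset.sum_insert hi]
    exact (h i (Finset.mem_insert_self _ _)).fun_add
      (ih fun j hj => h j (Finset.mem_insert_of_mem hj))

lemma absolutelyContinuousOnInterval_bilin (M : Matrix ι κ ℝ) {a : ℝ → ι → ℝ} {b : ℝ → κ → ℝ}
    {s t : ℝ} (ha : ∀ i, AbsolutelyContinuousOnInterval (fun u => a u i) s t)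
    (hb : ∀ i, AbsolutelyContinuousOnInterval (fun u => b u i) s t) :
    AbsolutelyContinuousOnInterval (fun u => a u ⬝ᵥ (M *ᵥ b u)) s t := by
  simp only [dotProduct, Matrix.mulVec]
  exact absolutelyContinuousOnInterval_sum fun i _ => (ha i).fun_mul <|
    absolutelyContinuousOnInterval_sum fun j _ => (hb j).const_mul _

lemma continuous_dotProduct_mulVec (M : Matrix ι ι ℝ) {x : ℝ → ι → ℝ} (hx : Continuous x) :
    Continuous fun t => x t ⬝ᵥ (M *ᵥ x t) := by
  simp only [dotProduct_mulVec_eq_sum]; fun_prop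

/-- The complete Lyapunov–Krasovskii functional, evaluated on the segment of `x` ending at `t`. -/
noncomputable def storage (r : ℝ) (g : ℝ → κ → ℝ) (P S U : Matrix ι ι ℝ)
    (Q : Matrix ι (κ × ι) ℝ) (R : Matrix (κ × ι) (κ × ι) ℝ) (x : ℝ → ι → ℝ) (t : ℝ) : ℝ :=
  x t ⬝ᵥ (P *ᵥ x t) + 2 * (x t ⬝ᵥ (Q *ᵥ moment r g x t))
    + moment r g x t ⬝ᵥ (R *ᵥ moment r g x t)
    + ∫ τ in (-r)..0, (x (t + τ) ⬝ᵥ (S *ᵥ x (t + τ)) + (τ + r) * (x (t + τ) ⬝ᵥ (U *ᵥ x (t + τ))))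

variable {r : ℝ} {g : ℝ → κ → ℝ} {Θ : Matrix κ κ ℝ} {P S U : Matrix ι ι ℝ}
  {Q : Matrix ι (κ × ι) ℝ} {R : Matrix (κ × ι) (κ × ι) ℝ} {x : ℝ → ι → ℝ}

lemma hasDerivAt_moment [DecidableEq ι] (hr : 0 ≤ r)
    (hg : ∀ τ ∈ Icc (-r) 0, HasDerivWithinAt g (Θ *ᵥ g τ) (Icc (-r) 0) τ)
    (hx : Continuous x) (t : ℝ) :
    HasDerivAt (moment r g x) ((fun k => g 0 k.1 * x t k.2) - (fun k => g (-r) k.1 * x (t - r) k.2)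
      - (Θ ⊗ₖ (1 : Matrix ι ι ℝ)) *ᵥ moment r g x t) t := by
  rw [hasDerivAt_pi]
  intro k
  have h := hasDerivAt_integral_kernel_mul hr hg (continuous_pi_iff.1 hx k.2) k.1 t
  refine h.congr_deriv ?_
  simp only [Pi.sub_apply, kronecker_one_mulVec Θ _ k.1 k.2, moment]

lemma hasDerivAt_storage [DecidableEq ι] (hr : 0 ≤ r)
    (hg : ∀ τ ∈ Icc (-r) 0, HasDerivWithinAt g (Θ *ᵥ g τ) (Icc (-r) 0) τ)
    (hP : P.IsSymm) (hR : R.IsSymm) (hx : Continuous x) {t : ℝ} {x' : ι → ℝ}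
    (hx' : HasDerivAt x x' t) :
    HasDerivAt (storage r g P S U Q R x)
      (2 * ((P *ᵥ x t + Q *ᵥ moment r g x t) ⬝ᵥ x')
        + 2 * ((Qᵀ *ᵥ x t + R *ᵥ moment r g x t) ⬝ᵥ
          ((fun k => g 0 k.1 * x t k.2) - (fun k => g (-r) k.1 * x (t - r) k.2)
            - (Θ ⊗ₖ (1 : Matrix ι ι ℝ)) *ᵥ moment r g x t))
        + (x t ⬝ᵥ (S *ᵥ x t) + r * (x t ⬝ᵥ (U *ᵥ x t)) - x (t - r) ⬝ᵥ (S *ᵥ x (t - r))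
          - ∫ τ in (-r)..0, x (t + τ) ⬝ᵥ (U *ᵥ x (t + τ)))) t := by
  have hm := hasDerivAt_moment hr hg hx t
  have h := (((hasDerivAt_dotProduct hx' (hasDerivAt_mulVec P hx')).add
    ((hasDerivAt_dotProduct hx' (hasDerivAt_mulVec Q hm)).const_mul 2)).add
    (hasDerivAt_dotProduct hm (hasDerivAt_mulVec R hm))).add
    (hasDerivAt_integral_add_ramp_mul hr (continuous_dotProduct_mulVec S hx)
      (continuous_dotProduct_mulVec U hx) t)
  refine h.congr_deriv ?_
  set m := moment r g x t
  set m' := (fun k : κ × ι => g 0 k.1 * x t k.2) - (fun k => g (-r) k.1 * x (t - r) k.2)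
      - (Θ ⊗ₖ (1 : Matrix ι ι ℝ)) *ᵥ m
  have e1 : x t ⬝ᵥ (P *ᵥ x') = (P *ᵥ x t) ⬝ᵥ x' := by
    rw [Matrix.dotProduct_mulVec, ← Matrix.mulVec_transpose, hP.eq]
  have e2 : x' ⬝ᵥ (P *ᵥ x t) = (P *ᵥ x t) ⬝ᵥ x' := dotProduct_comm _ _
  have e3 : m ⬝ᵥ (R *ᵥ m') = (R *ᵥ m) ⬝ᵥ m' := by
    rw [Matrix.dotProduct_mulVec, ← Matrix.mulVec_transpose, hR.eq]
  have e4 : m' ⬝ᵥ (R *ᵥ m) = (R *ᵥ m) ⬝ᵥ m' := dotProduct_comm _ _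
  have e5 : x t ⬝ᵥ (Q *ᵥ m') = (Qᵀ *ᵥ x t) ⬝ᵥ m' := by
    rw [Matrix.dotProduct_mulVec, ← Matrix.mulVec_transpose]
  have e6 : x' ⬝ᵥ (Q *ᵥ m) = (Q *ᵥ m) ⬝ᵥ x' := dotProduct_comm _ _
  rw [e1, e2, e3, e4, e5, e6, add_dotProduct, add_dotProduct]
  ring

/-- The moments and the window integral are C¹, since x is continuous; the quadratic terms inherit
absolute continuity from x and the moments through products. -/
lemma absolutelyContinuousOnInterval_storage [DecidableEq ι] (hr : 0 ≤ r)
    (hg : ∀ τ ∈ Icc (-r) 0, HasDerivWithinAt g (Θ *ᵥ g τ) (Icc (-r) 0) τ)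
    (hx : Continuous x) {a b : ℝ}
    (hac : ∀ i, AbsolutelyContinuousOnInterval (fun t => x t i) a b) :
    AbsolutelyContinuousOnInterval (storage r g P S U Q R x) a b := by
  have hmd := fun t => hasDerivAt_moment hr hg hx t
  have hmc : Continuous (moment r g x) :=
    continuous_iff_continuousAt.2 fun t => (hmd t).continuousAt
  have hm : ∀ k, AbsolutelyContinuousOnInterval (fun t => moment r g x t k) a b := fun k => by
    refine absolutelyContinuousOnInterval_of_hasDerivAt (fun t => hasDerivAt_pi.1 (hmd t) k) ?_ a b
    simp only [Pi.sub_apply, Matrix.mulVec, dotProduct]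
    fun_prop
  have hw : AbsolutelyContinuousOnInterval (fun t => ∫ τ in (-r)..0, (x (t + τ) ⬝ᵥ
      (S *ᵥ x (t + τ)) + (τ + r) * (x (t + τ) ⬝ᵥ (U *ᵥ x (t + τ))))) a b := by
    have hS := continuous_dotProduct_mulVec S hx
    have hU := continuous_dotProduct_mulVec U hx
    refine absolutelyContinuousOnInterval_of_hasDerivAt
      (fun t => hasDerivAt_integral_add_ramp_mul hr hS hU t) ?_ a b
    have h1 : Continuous fun t => ∫ τ in (-r)..0, x (t + τ) ⬝ᵥ (U *ᵥ x (t + τ)) :=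
      intervalIntegral.continuous_parametric_intervalIntegral_of_continuous'
        (f := fun t τ => x (t + τ) ⬝ᵥ (U *ᵥ x (t + τ)))
        (hU.comp (continuous_fst.add continuous_snd)) _ _
    exact ((hS.add (hU.const_mul r)).sub (hS.comp (continuous_id.sub continuous_const))).sub h1
  exact (((absolutelyContinuousOnInterval_bilin P hac hac).fun_add
    ((absolutelyContinuousOnInterval_bilin Q hac hm).const_mul 2)).fun_add
    (absolutelyContinuousOnInterval_bilin R hm hm)).fun_add hw

/-! ### Two-sided bounds on the storage functional. -/

lemma integral_dotProduct_add_ramp (hx : Continuous x) (t : ℝ) :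
    ∫ τ in (-r)..0, (x (t + τ) ⬝ᵥ (S *ᵥ x (t + τ)) + (τ + r) * (x (t + τ) ⬝ᵥ (U *ᵥ x (t + τ))))
      = (∫ τ in (-r)..0, x (t + τ) ⬝ᵥ (S *ᵥ x (t + τ)))
        + ∫ τ in (-r)..0, (τ + r) * (x (t + τ) ⬝ᵥ (U *ᵥ x (t + τ))) := by
  have hS := continuous_dotProduct_mulVec S hx
  have hU := continuous_dotProduct_mulVec U hx
  exact intervalIntegral.integral_add
    ((hS.comp (continuous_const.add continuous_id)).intervalIntegrable _ _)
    (((continuous_id.add continuous_const).mul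
      (hU.comp (continuous_const.add continuous_id))).intervalIntegrable _ _)

/-- Bessel for S bounds ∫ xᵀSx below by mᵀ(I ⊗ S)m, which completes R to the block R + I ⊗ S of the
hypothesis; the U term is nonnegative because τ + r ≥ 0 on the window. -/
lemma exists_pos_mul_le_storage [DecidableEq κ] (hr : 0 ≤ r)
    (hg : ContinuousOn g (Icc (-r) 0)) (hon : IsOrthonormal r g)
    (hPQR : (Matrix.fromBlocks P Q Qᵀ (R + (1 : Matrix κ κ ℝ) ⊗ₖ S)).PosDef)
    (hS : S.PosSemidef) (hU : U.PosSemidef) :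
    ∃ ε > 0, ∀ x : ℝ → ι → ℝ, Continuous x → ∀ t,
      ε * (x t ⬝ᵥ x t) ≤ storage r g P S U Q R x t := by
  obtain ⟨ε, hε, h⟩ := exists_pos_mul_dotProduct_le hPQR
  refine ⟨ε, hε, fun x hx t => ?_⟩
  set m := moment r g x t with hm
  have h1 := h (Sum.elim (x t) m)
  have hB := moment_dotProduct_kronecker_le hr hg hon hS hx t
  have hI : 0 ≤ ∫ τ in (-r)..0, (τ + r) * (x (t + τ) ⬝ᵥ (U *ᵥ x (t + τ))) :=
    intervalIntegral.integral_nonneg (by linarith) fun τ hτ =>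
      mul_nonneg (by linarith [hτ.1]) (by simpa using hU.dotProduct_mulVec_nonneg (x (t + τ)))
  have hm0 : 0 ≤ m ⬝ᵥ m := Finset.sum_nonneg fun _ _ => mul_self_nonneg _
  have e : m ⬝ᵥ (Qᵀ *ᵥ x t) = x t ⬝ᵥ (Q *ᵥ m) := by
    rw [Matrix.mulVec_transpose, dotProduct_comm, Matrix.dotProduct_mulVec]
  rw [Matrix.fromBlocks_mulVec, sumElim_dotProduct_sumElim, sumElim_dotProduct_sumElim] at h1
  simp only [Sum.elim_comp_inl, Sum.elim_comp_inr, dotProduct_add, Matrix.add_mulVec, e] at h1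
  rw [storage, integral_dotProduct_add_ramp hx]
  nlinarith [mul_nonneg hε.le hm0]

/-- Bessel with the identity weight gives |m|² ≤ ∫|x|², so the quadratic part is controlled by the
same quantity as the integral part. No definiteness is needed. -/
lemma exists_pos_storage_le_mul [DecidableEq κ] [DecidableEq ι] (hr : 0 ≤ r)
    (hg : ContinuousOn g (Icc (-r) 0)) (hon : IsOrthonormal r g)
    (P S U : Matrix ι ι ℝ) (Q : Matrix ι (κ × ι) ℝ) (R : Matrix (κ × ι) (κ × ι) ℝ) :
    ∃ C > 0, ∀ x : ℝ → ι → ℝ, Continuous x → ∀ t,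
      storage r g P S U Q R x t ≤ C * (x t ⬝ᵥ x t + ∫ τ in (-r)..0, x (t + τ) ⬝ᵥ x (t + τ)) := by
  obtain ⟨C, hC, h⟩ := exists_pos_dotProduct_le_mul (Matrix.fromBlocks P Q Qᵀ R)
  obtain ⟨CS, hCS, hS⟩ := exists_pos_dotProduct_le_mul S
  obtain ⟨CU, hCU, hU⟩ := exists_pos_dotProduct_le_mul U
  refine ⟨C + CS + r * CU, by positivity, fun x hx t => ?_⟩
  set m := moment r g x t with hm
  have h1 := h (Sum.elim (x t) m)
  have hB := moment_dotProduct_kronecker_le hr hg hon (Matrix.PosSemidef.one (n := ι) (R := ℝ)) hx t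
  simp only [Matrix.one_kronecker_one, Matrix.one_mulVec, ← hm] at hB
  have e : m ⬝ᵥ (Qᵀ *ᵥ x t) = x t ⬝ᵥ (Q *ᵥ m) := by
    rw [Matrix.mulVec_transpose, dotProduct_comm, Matrix.dotProduct_mulVec]
  rw [Matrix.fromBlocks_mulVec, sumElim_dotProduct_sumElim, sumElim_dotProduct_sumElim] at h1
  simp only [Sum.elim_comp_inl, Sum.elim_comp_inr, dotProduct_add, e] at h1
  have hxx : Continuous fun t => x t ⬝ᵥ x t := by
    simpa using continuous_dotProduct_mulVec (1 : Matrix ι ι ℝ) hx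
  have hcS := continuous_dotProduct_mulVec S hx
  have hcU := continuous_dotProduct_mulVec U hx
  have ht : Continuous fun τ : ℝ => t + τ := by fun_prop
  have hx0 : 0 ≤ x t ⬝ᵥ x t := Finset.sum_nonneg fun _ _ => mul_self_nonneg _
  have hI : ∫ τ in (-r)..0, (x (t + τ) ⬝ᵥ (S *ᵥ x (t + τ))
      + (τ + r) * (x (t + τ) ⬝ᵥ (U *ᵥ x (t + τ))))
      ≤ ∫ τ in (-r)..0, (CS + r * CU) * (x (t + τ) ⬝ᵥ x (t + τ)) := by
    refine intervalIntegral.integral_mono_on (by linarith)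
      (((hcS.comp ht).add ((continuous_id.add continuous_const).mul
        (hcU.comp ht))).intervalIntegrable _ _)
      (((hxx.comp ht).const_mul _).intervalIntegrable _ _) fun τ hτ => ?_
    have h0 : 0 ≤ x (t + τ) ⬝ᵥ x (t + τ) := Finset.sum_nonneg fun _ _ => mul_self_nonneg _
    have h2 : (τ + r) * (x (t + τ) ⬝ᵥ (U *ᵥ x (t + τ)))
        ≤ r * (CU * (x (t + τ) ⬝ᵥ x (t + τ))) :=
      (mul_le_mul_of_nonneg_left (hU _) (by linarith [hτ.1])).trans
        (mul_le_mul_of_nonneg_right (by linarith [hτ.2]) (by positivity))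
    linarith [hS (x (t + τ))]
  rw [intervalIntegral.integral_const_mul] at hI
  rw [storage]
  have h3 : 0 ≤ (CS + r * CU) * (x t ⬝ᵥ x t) := by positivity
  nlinarith [mul_le_mul_of_nonneg_left hB hC.le]

end Storage

/-! ### The matrix inequality as a quadratic form -/

lemma dotProduct_Sy_mul_mulVec {ι κ : Type} [Fintype ι] [Fintype κ] (X : Matrix ι κ ℝ)
    (Y : Matrix κ ι ℝ) (z : ι → ℝ) :
    z ⬝ᵥ (Sy (X * Y) *ᵥ z) = 2 * ((Xᵀ *ᵥ z) ⬝ᵥ (Y *ᵥ z)) := by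
  have h : z ⬝ᵥ ((X * Y) *ᵥ z) = (Xᵀ *ᵥ z) ⬝ᵥ (Y *ᵥ z) := by
    rw [← Matrix.mulVec_mulVec, Matrix.dotProduct_mulVec, Matrix.mulVec_transpose]
  have h' : z ⬝ᵥ ((X * Y)ᵀ *ᵥ z) = (Xᵀ *ᵥ z) ⬝ᵥ (Y *ᵥ z) := by
    rw [Matrix.mulVec_transpose, dotProduct_comm, ← Matrix.dotProduct_mulVec, h]
  rw [Sy, Matrix.add_mulVec, dotProduct_add, h, h']
  ring

lemma dotProduct_dsum_mulVec {ι κ : Type} [Fintype ι] [Fintype κ] (X : Matrix ι ι ℝ)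
    (Y : Matrix κ κ ℝ) (a : ι → ℝ) (b : κ → ℝ) :
    Sum.elim a b ⬝ᵥ (dsum X Y *ᵥ Sum.elim a b) = a ⬝ᵥ (X *ᵥ a) + b ⬝ᵥ (Y *ᵥ b) := by
  simp [dsum, Matrix.fromBlocks_mulVec, sumElim_dotProduct_sumElim]

section ClosedLoop

variable {n p d q m : ℕ}

/-- The right-hand side of the closed loop in terms of `χ(t)`, `χ(t-r)`, the moments and `w(t)`. -/
def closedLoopField (G : Plant n p q m) (K : Gains n p d) (a b : StateIx n p → ℝ)
    (e : KerIx n p d → ℝ) (w : Fin q → ℝ) : StateIx n p → ℝ :=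
  Sum.elim (G.A *ᵥ (a ∘ Sum.inl) + G.B *ᵥ (b ∘ Sum.inr) + G.D₁ *ᵥ w)
    (K.K₁ *ᵥ a + K.K₂ *ᵥ b + K.K₃ *ᵥ e + G.D₂ *ᵥ w)

lemma closedLoop_mulVec (G : Plant n p q m) (K : Gains n p d) (a b : StateIx n p → ℝ)
    (e : KerIx n p d → ℝ) (w : Fin q → ℝ) (y : Fin m → ℝ) :
    (bigA d G + bigB n p * bigK q m K) *ᵥ
        (Sum.elim a (Sum.elim b (Sum.elim e (Sum.elim w y)))) = closedLoopField G K a b e w := by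
  rw [Matrix.add_mulVec, ← Matrix.mulVec_mulVec]
  simp only [bigA, bigB, bigK, Matrix.fromCols_mulVec_sumElim, Matrix.fromRows_mulVec,
    Matrix.fromBlocks_mulVec, Matrix.zero_mulVec, Matrix.one_mulVec, closedLoopField]
  ext (i | i)
  · simp [add_assoc]
  · simp
    ring

lemma dotProduct_PhiHat_mulVec (G : Plant n p q m) (K : Gains n p d) (r : ℝ) (f : ℝ → Fin d → ℝ)
    (Pi : Matrix (Fin d) (Fin d) ℝ) (C₃ : Matrix (Fin m) (KerIx n p d) ℝ) (J : Supply q m)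
    {P : Matrix (StateIx n p) (StateIx n p) ℝ}
    (Q : Matrix (StateIx n p) (KerIx n p d) ℝ) {R : Matrix (KerIx n p d) (KerIx n p d) ℝ}
    (S U : Matrix (StateIx n p) (StateIx n p) ℝ) (hR : R.IsSymm)
    (a b : StateIx n p → ℝ) (e : KerIx n p d → ℝ) (w : Fin q → ℝ) (y : Fin m → ℝ) :
    (Sum.elim a (Sum.elim b (Sum.elim e (Sum.elim w y)))) ⬝ᵥ
      (PhiHat G K r f Pi C₃ J P Q R S U *ᵥ Sum.elim a (Sum.elim b (Sum.elim e (Sum.elim w y))))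
    = 2 * ((P *ᵥ a + Q *ᵥ e) ⬝ᵥ closedLoopField G K a b e w)
      + 2 * ((Qᵀ *ᵥ a + R *ᵥ e) ⬝ᵥ (kernelF n p r f 0 *ᵥ a - kernelF n p r f (-r) *ᵥ b
          - PiHat n p r f Pi *ᵥ e))
      + (a ⬝ᵥ (S *ᵥ a) + r * (a ⬝ᵥ (U *ᵥ a)) - b ⬝ᵥ (S *ᵥ b)
        - e ⬝ᵥ (((1 : Matrix (Fin d) (Fin d) ℝ) ⊗ₖ U) *ᵥ e))
      - w ⬝ᵥ (J.J₃ *ᵥ w) + y ⬝ᵥ (J.J₁ *ᵥ y)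
      + 2 * ((J.Jtᵀ *ᵥ y - J.J₂ *ᵥ w) ⬝ᵥ (G.C₁ *ᵥ a + G.C₂ *ᵥ b + C₃ *ᵥ e + G.D₃ *ᵥ w)) := by
  have h1 : (colQR q m Q R)ᵀ *ᵥ (Sum.elim a (Sum.elim b (Sum.elim e (Sum.elim w y))))
      = Qᵀ *ᵥ a + R *ᵥ e := by
    simp only [colQR, Matrix.transpose_fromRows, Matrix.fromCols_mulVec_sumElim,
      Matrix.transpose_zero, Matrix.zero_mulVec, hR.eq, zero_add, add_zero]
  have h2 : rowF q m r f Pi *ᵥ (Sum.elim a (Sum.elim b (Sum.elim e (Sum.elim w y))))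
      = kernelF n p r f 0 *ᵥ a - kernelF n p r f (-r) *ᵥ b - PiHat n p r f Pi *ᵥ e := by
    simp only [rowF, Matrix.fromCols_mulVec_sumElim, Matrix.neg_mulVec, Matrix.zero_mulVec,
      add_zero]
    abel
  have h3 : (colJ n p d J)ᵀ *ᵥ (Sum.elim a (Sum.elim b (Sum.elim e (Sum.elim w y))))
      = J.Jtᵀ *ᵥ y - J.J₂ *ᵥ w := by
    simp only [colJ, Matrix.transpose_fromRows, Matrix.fromCols_mulVec_sumElim,
      Matrix.transpose_zero, Matrix.zero_mulVec, Matrix.transpose_neg, Matrix.transpose_transpose,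
      Matrix.neg_mulVec, zero_add]
    abel
  have h4 : bigSigma G C₃ *ᵥ (Sum.elim a (Sum.elim b (Sum.elim e (Sum.elim w y))))
      = G.C₁ *ᵥ a + G.C₂ *ᵥ b + C₃ *ᵥ e + G.D₃ *ᵥ w := by
    simp only [bigSigma, Matrix.fromCols_mulVec_sumElim, Matrix.zero_mulVec, add_zero, add_assoc]
  have h5 : bigP q m P Q *ᵥ (Sum.elim a (Sum.elim b (Sum.elim e (Sum.elim w y))))
      = P *ᵥ a + Q *ᵥ e := by
    simp only [bigP, Matrix.fromCols_mulVec_sumElim, Matrix.zero_mulVec, add_zero, zero_add]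
  -- Definitional unfolding with the matrix product instance spelled out, so that the products have
  -- the form expected by `dotProduct_Sy_mul_mulVec`.
  have h6 : PhiHat G K r f Pi C₃ J P Q R S U
      = Sy (Matrix.instHMulOfFintypeOfMulOfAddCommMonoid.hMul (colQR q m Q R) (rowF q m r f Pi))
        + dsum (S + r • U) (dsum (-S) (dsum (-((1 : Matrix (Fin d) (Fin d) ℝ) ⊗ₖ U))
          (dsum (-J.J₃) J.J₁)))
        + Sy (Matrix.instHMulOfFintypeOfMulOfAddCommMonoid.hMul (colJ n p d J) (bigSigma G C₃))
        + Sy (Matrix.instHMulOfFintypeOfMulOfAddCommMonoid.hMul (bigP q m P Q)ᵀ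
          (bigA d G + bigB n p * bigK q m K)) := rfl
  rw [h6]
  simp only [Matrix.add_mulVec, dotProduct_add, dotProduct_Sy_mul_mulVec,
    dotProduct_dsum_mulVec, h1, h2, h3, h4, h5, Matrix.transpose_transpose, Matrix.neg_mulVec,
    dotProduct_neg, Matrix.smul_mulVec, dotProduct_smul, smul_eq_mul]
  have h7 := closedLoop_mulVec G K a b e w y
  simp only [Matrix.add_mulVec] at h7
  rw [← h7, dotProduct_add]
  ring

lemma rate_eq (J : Supply q m) (z : EuclideanSpace ℝ (Fin m)) (w : EuclideanSpace ℝ (Fin q)) :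
    J.rate z w = (J.Jt *ᵥ z.ofLp) ⬝ᵥ (J.J₁⁻¹ *ᵥ (J.Jt *ᵥ z.ofLp))
      + 2 * ((J.J₂ *ᵥ w.ofLp) ⬝ᵥ z.ofLp) + w.ofLp ⬝ᵥ (J.J₃ *ᵥ w.ofLp) := by
  rw [Supply.rate, Matrix.fromBlocks_mulVec, sumElim_dotProduct_sumElim]
  simp only [Sum.elim_comp_inl, Sum.elim_comp_inr, dotProduct_add]
  have e1 : z.ofLp ⬝ᵥ ((J.Jtᵀ * J.J₁⁻¹ * J.Jt) *ᵥ z.ofLp)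
      = (J.Jt *ᵥ z.ofLp) ⬝ᵥ (J.J₁⁻¹ *ᵥ (J.Jt *ᵥ z.ofLp)) := by
    rw [← Matrix.mulVec_mulVec, ← Matrix.mulVec_mulVec, Matrix.dotProduct_mulVec,
      Matrix.vecMul_transpose]
  have e2 : w.ofLp ⬝ᵥ (J.J₂ᵀ *ᵥ z.ofLp) = (J.J₂ *ᵥ w.ofLp) ⬝ᵥ z.ofLp := by
    rw [Matrix.dotProduct_mulVec, Matrix.vecMul_transpose]
  rw [e1, e2, dotProduct_comm z.ofLp]
  ring

/-- The choice of the Schur complement variable that eliminates `J₁`. -/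
lemma schur_elimination {J₁ Jt : Matrix (Fin m) (Fin m) ℝ} (hJ₁ : (-(J₁⁻¹)).PosDef)
    (z : Fin m → ℝ) :
    (-(J₁⁻¹ *ᵥ (Jt *ᵥ z))) ⬝ᵥ (J₁ *ᵥ (-(J₁⁻¹ *ᵥ (Jt *ᵥ z))))
        + 2 * ((Jtᵀ *ᵥ (-(J₁⁻¹ *ᵥ (Jt *ᵥ z)))) ⬝ᵥ z)
      = -((Jt *ᵥ z) ⬝ᵥ (J₁⁻¹ *ᵥ (Jt *ᵥ z))) := by
  -- Definiteness is assumed for J₁⁻¹ only; an invertible `J₁⁻¹` forces J₁ to be invertible.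
  have hu : IsUnit J₁ := by
    have := hJ₁.isUnit
    rw [IsUnit.neg_iff] at this
    exact (Matrix.isUnit_nonsing_inv_iff).1 this
  have hdet := (Matrix.isUnit_iff_isUnit_det _).1 hu
  have e1 : J₁ *ᵥ (J₁⁻¹ *ᵥ (Jt *ᵥ z)) = Jt *ᵥ z := by
    rw [Matrix.mulVec_mulVec, Matrix.mul_nonsing_inv _ hdet, Matrix.one_mulVec]
  have e2 : (Jtᵀ *ᵥ (J₁⁻¹ *ᵥ (Jt *ᵥ z))) ⬝ᵥ z = (Jt *ᵥ z) ⬝ᵥ (J₁⁻¹ *ᵥ (Jt *ᵥ z)) := by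
    rw [Matrix.mulVec_transpose, ← Matrix.dotProduct_mulVec, dotProduct_comm]
  simp only [Matrix.mulVec_neg, e1, neg_dotProduct, dotProduct_neg, e2]
  rw [dotProduct_comm (J₁⁻¹ *ᵥ _)]
  ring

end ClosedLoop

/-! ### Absolute continuity and Grönwall's inequality -/

/-- Serves twice: to pass to coordinates of a solution, and to replace t ↦ v(χ_t) by a function
agreeing with it only on the interval. -/
lemma absolutelyContinuousOnInterval_of_dist_le {X Y : Type*} [PseudoMetricSpace X]
    [PseudoMetricSpace Y] {f : ℝ → X} {h : ℝ → Y} {a b : ℝ}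
    (hh : AbsolutelyContinuousOnInterval h a b)
    (hd : ∀ s ∈ uIcc a b, ∀ t ∈ uIcc a b, dist (f s) (f t) ≤ dist (h s) (h t)) :
    AbsolutelyContinuousOnInterval f a b := by
  rw [absolutelyContinuousOnInterval_iff] at hh ⊢
  intro ε hε
  obtain ⟨δ, hδ, H⟩ := hh ε hε
  refine ⟨δ, hδ, fun E hE hlt => (Finset.sum_le_sum fun i hi => ?_).trans_lt (H E hE hlt)⟩
  exact hd _ (hE.1 i hi).1 _ (hE.1 i hi).2

/-- The function exp(αt)V(t) is absolutely continuous with derivative ≤ 0 almost everywhere;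
integrate the derivative. -/
lemma le_exp_mul_of_ae_hasDerivAt_le {V : ℝ → ℝ} {α a b : ℝ} (hab : a ≤ b)
    (hV : AbsolutelyContinuousOnInterval V a b)
    (hd : ∀ᵐ t ∂volume.restrict (Icc a b), ∃ v', HasDerivAt V v' t ∧ v' ≤ -α * V t) :
    V b ≤ Real.exp (-α * (b - a)) * V a := by
  have hexp : ∀ t, HasDerivAt (fun t => Real.exp (α * t)) (Real.exp (α * t) * α) t := fun t => by
    simpa using ((hasDerivAt_id t).const_mul α).exp
  have hac : AbsolutelyContinuousOnInterval (fun t => Real.exp (α * t) * V t) a b :=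
    (absolutelyContinuousOnInterval_of_hasDerivAt hexp (by fun_prop) a b).fun_mul hV
  have h := hac.integral_deriv_eq_sub
  have hle : ∫ t in a..b, deriv (fun t => Real.exp (α * t) * V t) t ≤ ∫ _ in a..b, (0 : ℝ) := by
    refine intervalIntegral.integral_mono_ae_restrict hab hac.intervalIntegrable_deriv
      (by simp) ?_
    filter_upwards [hd] with t ht
    obtain ⟨v', hv', hle⟩ := ht
    rw [((hexp t).fun_mul hv').deriv]
    nlinarith [Real.exp_pos (α * t)]
  rw [h, intervalIntegral.integral_zero, sub_nonpos] at hle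
  have e : Real.exp (-α * (b - a)) = (Real.exp (α * b))⁻¹ * Real.exp (α * a) := by
    rw [← Real.exp_neg, ← Real.exp_add]; ring_nf
  rw [e, mul_assoc, ← div_eq_inv_mul, le_div_iff₀ (Real.exp_pos _)]
  linarith

/-! ### Differentiability on the space of histories -/

/-- A linear functional of the history, bounded in sup norm by r times a bound for |k| on the
window. -/
lemma differentiable_integral_mul_IccExtend {r : ℝ} (hr : -r ≤ 0) {k : ℝ → ℝ}
    (hk : ContinuousOn k (Icc (-r) 0)) :
    Differentiable ℝ fun h : C(Icc (-r) 0, ℝ) => ∫ τ in (-r)..0, k τ * IccExtend hr h τ := by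
  obtain ⟨C, hC⟩ := isCompact_Icc.exists_bound_of_continuousOn hk
  have hcont : ∀ h : C(Icc (-r) 0, ℝ), Continuous (IccExtend hr h) := fun h =>
    h.continuous.Icc_extend'
  have hint : ∀ h : C(Icc (-r) 0, ℝ),
      IntervalIntegrable (fun τ => k τ * IccExtend hr h τ) volume (-r) 0 := fun h => by
    apply ContinuousOn.intervalIntegrable
    rw [uIcc_of_le hr]
    exact hk.mul (hcont h).continuousOn
  let L : C(Icc (-r) 0, ℝ) →ₗ[ℝ] ℝ :=
    { toFun := fun h => ∫ τ in (-r)..0, k τ * IccExtend hr h τ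
      map_add' := fun h₁ h₂ => by
        rw [← intervalIntegral.integral_add (hint h₁) (hint h₂)]
        simp [IccExtend, mul_add]
      map_smul' := fun c h => by
        rw [RingHom.id_apply, smul_eq_mul, ← intervalIntegral.integral_const_mul]
        simp [IccExtend, mul_left_comm] }
  refine (L.mkContinuous (C * |0 - (-r)|) fun h => ?_).differentiable
  have := intervalIntegral.norm_integral_le_of_norm_le_const (a := -r) (b := 0)
    (C := C * ‖h‖) (f := fun τ => k τ * IccExtend hr h τ) fun τ hτ => by
      rw [uIoc_of_le hr] at hτ
      rw [norm_mul]
      have h1 := hC τ ⟨hτ.1.le, hτ.2⟩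
      exact mul_le_mul h1 (h.norm_coe_le_norm _) (norm_nonneg _) ((norm_nonneg _).trans h1)
  calc _ ≤ _ := this
    _ = _ := by ring

lemma storage_congr {ι κ : Type*} [Fintype ι] [Fintype κ] {r : ℝ} (hr : 0 ≤ r) (g : ℝ → κ → ℝ)
    (P S U : Matrix ι ι ℝ) (Q : Matrix ι (κ × ι) ℝ) (R : Matrix (κ × ι) (κ × ι) ℝ)
    {x y : ℝ → ι → ℝ} {s t : ℝ} (h : ∀ τ ∈ Icc (-r) 0, x (s + τ) = y (t + τ)) :
    storage r g P S U Q R x s = storage r g P S U Q R y t := by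
  have hu : uIcc (-r) 0 = Icc (-r) 0 := uIcc_of_le (by linarith)
  have h0 : x s = y t := by simpa using h 0 ⟨by linarith, le_rfl⟩
  have hm : moment r g x s = moment r g y t := by
    ext k
    exact intervalIntegral.integral_congr fun τ hτ => by
      rw [h τ (hu ▸ hτ)]
  rw [storage, storage, h0, hm]
  congr 1
  exact intervalIntegral.integral_congr fun τ hτ => by
    rw [h τ (hu ▸ hτ)]

/-- The coordinates of a history, extended to the real line. -/
noncomputable def historyExtend {n p : ℕ} {r : ℝ} (hr : -r ≤ 0) (φ : History n p r) (τ : ℝ) :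
    StateIx n p → ℝ :=
  (IccExtend hr φ τ).ofLp

/-- Point values and moments are continuous linear in the history. Each quadratic integrand is a
polynomial in the coordinates within the algebra C([-r,0]; ℝ), followed by a bounded linear
functional. -/
lemma differentiable_storage_historyExtend {n p : ℕ} {κ : Type*} [Fintype κ] {r : ℝ}
    (hr : -r ≤ 0) {g : ℝ → κ → ℝ} (hg : ContinuousOn g (Icc (-r) 0))
    (P S U : Matrix (StateIx n p) (StateIx n p) ℝ) (Q : Matrix (StateIx n p) (κ × StateIx n p) ℝ)
    (R : Matrix (κ × StateIx n p) (κ × StateIx n p) ℝ) :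
    Differentiable ℝ fun φ : History n p r =>
      storage r g P S U Q R (historyExtend hr φ) 0 := by
  let π : StateIx n p → History n p r →L[ℝ] C(Icc (-r) 0, ℝ) := fun j =>
    (EuclideanSpace.proj (𝕜 := ℝ) j : State n p →L[ℝ] ℝ).compLeftContinuous ℝ (Icc (-r) 0)
  have hπ : ∀ j φ τ, historyExtend hr φ τ j = IccExtend hr (π j φ) τ := fun _ _ _ => rfl
  have hval : ∀ j, Differentiable ℝ fun φ : History n p r => historyExtend hr φ 0 j := fun j =>
    ((ContinuousMap.evalCLM ℝ (projIcc (-r) 0 hr 0)).comp (π j)).differentiable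
  have hmom : ∀ k, Differentiable ℝ fun φ : History n p r =>
      moment r g (historyExtend hr φ) 0 k := fun k => by
    simp only [moment, zero_add, hπ]
    exact (differentiable_integral_mul_IccExtend hr (continuousOn_pi.1 hg k.1)).comp
      (π k.2).differentiable
  have hquad : ∀ (M : Matrix (StateIx n p) (StateIx n p) ℝ) (k : ℝ → ℝ),
      ContinuousOn k (Icc (-r) 0) → Differentiable ℝ fun φ : History n p r =>
        ∫ τ in (-r)..0, k τ * (historyExtend hr φ τ ⬝ᵥ (M *ᵥ historyExtend hr φ τ)) := by
    intro M k hk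
    have e : ∀ φ τ, historyExtend hr φ τ ⬝ᵥ (M *ᵥ historyExtend hr φ τ)
        = IccExtend hr (∑ i, ∑ j, M i j • (π i φ * π j φ) : C(Icc (-r) 0, ℝ)) τ := by
      intro φ τ
      simp only [dotProduct_mulVec_eq_sum, hπ, IccExtend, Function.comp_apply,
        ContinuousMap.coe_sum, Finset.sum_apply, ContinuousMap.smul_apply, ContinuousMap.mul_apply,
        smul_eq_mul]
    simp only [e]
    refine (differentiable_integral_mul_IccExtend hr hk).comp ?_
    have hp : ∀ j, Differentiable ℝ fun φ => π j φ := fun j => (π j).differentiable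
    fun_prop
  have hsplit : ∀ φ : History n p r, ∫ τ in (-r)..0, (historyExtend hr φ (0 + τ) ⬝ᵥ
        (S *ᵥ historyExtend hr φ (0 + τ)) + (τ + r) * (historyExtend hr φ (0 + τ) ⬝ᵥ
        (U *ᵥ historyExtend hr φ (0 + τ))))
      = (∫ τ in (-r)..0, 1 * (historyExtend hr φ τ ⬝ᵥ (S *ᵥ historyExtend hr φ τ)))
        + ∫ τ in (-r)..0, (τ + r) * (historyExtend hr φ τ ⬝ᵥ (U *ᵥ historyExtend hr φ τ)) := by
    intro φ
    rw [integral_dotProduct_add_ramp]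
    · simp only [zero_add, one_mul]
    · exact (PiLp.continuous_ofLp 2 _).comp φ.continuous.Icc_extend'
  have h1 := hquad S (fun _ => 1) continuousOn_const
  have h2 := hquad U (fun τ => τ + r) (by fun_prop)
  simp only [storage, hsplit]
  simp only [dotProduct, Matrix.mulVec] at h1 h2 ⊢
  fun_prop

section Synthesis

variable {n p d q m : ℕ}

/-! ### The dissipation inequality -/

/-- The output in terms of `χ(t)`, `χ(t-r)`, the moments and `w(t)`. -/
def outputOf (G : Plant n p q m) (C₃ : Matrix (Fin m) (KerIx n p d) ℝ)
    (a b : StateIx n p → ℝ) (e : KerIx n p d → ℝ) (w : EuclideanSpace ℝ (Fin q)) :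
    EuclideanSpace ℝ (Fin m) :=
  WithLp.toLp 2 (G.C₁ *ᵥ a + G.C₂ *ᵥ b + C₃ *ᵥ e + G.D₃ *ᵥ w.ofLp)

/-- The quadratic form of `PhiHat` at the Schur complement vector is the derivative of the storage
functional minus the supply rate, with the integral of `χᵀ U χ` replaced by its Bessel bound. -/
lemma exists_dotProduct_PhiHat_mulVec_eq (G : Plant n p q m) (K : Gains n p d) (r : ℝ)
    (f : ℝ → Fin d → ℝ) (Pi : Matrix (Fin d) (Fin d) ℝ) (C₃ : Matrix (Fin m) (KerIx n p d) ℝ)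
    (J : Supply q m) (hJ₁ : (-(J.J₁⁻¹)).PosDef) (P : Matrix (StateIx n p) (StateIx n p) ℝ)
    (Q : Matrix (StateIx n p) (KerIx n p d) ℝ) {R : Matrix (KerIx n p d) (KerIx n p d) ℝ}
    (S U : Matrix (StateIx n p) (StateIx n p) ℝ) (hR : R.IsSymm)
    (a b : StateIx n p → ℝ) (e : KerIx n p d → ℝ) (w : EuclideanSpace ℝ (Fin q)) :
    ∃ y : Fin m → ℝ,
      (Sum.elim a (Sum.elim b (Sum.elim e (Sum.elim w.ofLp y)))) ⬝ᵥ
        (PhiHat G K r f Pi C₃ J P Q R S U *ᵥ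
          Sum.elim a (Sum.elim b (Sum.elim e (Sum.elim w.ofLp y))))
      = 2 * ((P *ᵥ a + Q *ᵥ e) ⬝ᵥ closedLoopField G K a b e w.ofLp)
        + 2 * ((Qᵀ *ᵥ a + R *ᵥ e) ⬝ᵥ (kernelF n p r f 0 *ᵥ a - kernelF n p r f (-r) *ᵥ b
            - PiHat n p r f Pi *ᵥ e))
        + (a ⬝ᵥ (S *ᵥ a) + r * (a ⬝ᵥ (U *ᵥ a)) - b ⬝ᵥ (S *ᵥ b)
          - e ⬝ᵥ (((1 : Matrix (Fin d) (Fin d) ℝ) ⊗ₖ U) *ᵥ e))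
        - J.rate (outputOf G C₃ a b e w) w := by
  set z := outputOf G C₃ a b e w with hz
  -- The stationary point in y of yᵀJ₁y + 2yᵀJ̃z, where its value is −zᵀJ̃ᵀJ₁⁻¹J̃z.
  refine ⟨-(J.J₁⁻¹ *ᵥ (J.Jt *ᵥ z.ofLp)), ?_⟩
  rw [dotProduct_PhiHat_mulVec G K r f Pi C₃ J Q S U hR, rate_eq]
  have h := schur_elimination (Jt := J.Jt) hJ₁ z.ofLp
  have hz' : G.C₁ *ᵥ a + G.C₂ *ᵥ b + C₃ *ᵥ e + G.D₃ *ᵥ w.ofLp = z.ofLp := rfl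
  rw [hz', sub_dotProduct]
  linarith

/-- The hypotheses of the synthesis theorem on the matrices and the kernel. -/
structure IsFeasible (G : Plant n p q m) (K : Gains n p d) (r : ℝ) (f : ℝ → Fin d → ℝ)
    (Pi : Matrix (Fin d) (Fin d) ℝ) (C₃ : Matrix (Fin m) (KerIx n p d) ℝ) (J : Supply q m)
    (P : Matrix (StateIx n p) (StateIx n p) ℝ)
    (Q : Matrix (StateIx n p) (KerIx n p d) ℝ) (R : Matrix (KerIx n p d) (KerIx n p d) ℝ)
    (S U : Matrix (StateIx n p) (StateIx n p) ℝ) : Prop where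
  delay_nonneg : 0 ≤ r
  supply : (-(J.J₁⁻¹)).PosDef
  kernel : ∀ τ ∈ Icc (-r) 0, HasDerivWithinAt f (Pi *ᵥ f τ) (Icc (-r) 0) τ
  gram_posDef : (gram r f).PosDef
  symmP : P.IsSymm
  symmR : R.IsSymm
  posDef_block : (Matrix.fromBlocks P Q Qᵀ (R + (1 : Matrix (Fin d) (Fin d) ℝ) ⊗ₖ S)).PosDef
  posDef_S : S.PosDef
  posDef_U : U.PosDef
  posDef_neg_PhiHat : (-(PhiHat G K r f Pi C₃ J P Q R S U)).PosDef

variable {G : Plant n p q m} {K : Gains n p d} {r : ℝ} {f : ℝ → Fin d → ℝ}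
  {Pi : Matrix (Fin d) (Fin d) ℝ} {C₃ : Matrix (Fin m) (KerIx n p d) ℝ} {J : Supply q m}
  {P : Matrix (StateIx n p) (StateIx n p) ℝ}
  {Q : Matrix (StateIx n p) (KerIx n p d) ℝ} {R : Matrix (KerIx n p d) (KerIx n p d) ℝ}
  {S U : Matrix (StateIx n p) (StateIx n p) ℝ}

/-- The derivative of the storage functional along the closed loop, with both the dissipation
inequality and the strict decay it leaves. -/
lemma IsFeasible.exists_decay (H : IsFeasible G K r f Pi C₃ J P Q R S U) :
    ∃ β > 0, ∀ (x : ℝ → StateIx n p → ℝ) (w : EuclideanSpace ℝ (Fin q)) (t : ℝ), Continuous x →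
      HasDerivAt x (closedLoopField G K (x t) (x (t - r))
        (moment r (fun τ => sqrtF r f *ᵥ f τ) x t) w.ofLp) t →
      ∃ v', HasDerivAt (storage r (fun τ => sqrtF r f *ᵥ f τ) P S U Q R x) v' t ∧
        v' - J.rate (outputOf G C₃ (x t) (x (t - r))
          (moment r (fun τ => sqrtF r f *ᵥ f τ) x t) w) w
          ≤ -β * (x t ⬝ᵥ x t + ∫ τ in (-r)..0, x (t + τ) ⬝ᵥ x (t + τ)) := by
  have hr := H.delay_nonneg
  have hf : ContinuousOn f (Icc (-r) 0) := fun τ hτ => (H.kernel τ hτ).continuousWithinAt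
  have hg := hasDerivWithinAt_sqrtF_mulVec H.gram_posDef H.kernel
  have hgc : ContinuousOn (fun τ => sqrtF r f *ᵥ f τ) (Icc (-r) 0) :=
    fun τ hτ => (hg τ hτ).continuousWithinAt
  have hon := isOrthonormal_sqrtF_mulVec hf hr H.gram_posDef
  obtain ⟨ε, hε, hΦ⟩ := exists_pos_mul_dotProduct_le H.posDef_neg_PhiHat
  obtain ⟨εU, hεU, hU⟩ := exists_pos_mul_dotProduct_le H.posDef_U
  obtain ⟨CU, hCU, hCU'⟩ := exists_pos_dotProduct_le_mul ((1 : Matrix (Fin d) (Fin d) ℝ) ⊗ₖ U)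
  -- By Bessel E − I ≤ 0, so for δ ≤ 1 it is at most δ(E − I). The choice δ·CU ≤ ε lets the strict
  -- term −ε|e|² absorb δE, while −δI supplies the decay in ∫|x|².
  set δ := min 1 (ε / CU) with hδ
  have hδ0 : 0 < δ := lt_min one_pos (by positivity)
  have hδ1 : δ ≤ 1 := min_le_left _ _
  have hδε : δ * CU ≤ ε := (le_div_iff₀ hCU).1 (min_le_right _ _)
  refine ⟨min ε (δ * εU), lt_min hε (by positivity), fun x w t hx hx' => ?_⟩
  have hd := hasDerivAt_storage (P := P) (S := S) (U := U) (Q := Q) (R := R) hr hg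
    H.symmP H.symmR hx hx'
  refine ⟨_, hd, ?_⟩
  set e := moment r (fun τ => sqrtF r f *ᵥ f τ) x t with he
  obtain ⟨y, hy⟩ := exists_dotProduct_PhiHat_mulVec_eq G K r f Pi C₃ J H.supply P Q S U H.symmR
    (x t) (x (t - r)) e w
  have h1 := hΦ (Sum.elim (x t) (Sum.elim (x (t - r)) (Sum.elim e (Sum.elim w.ofLp y))))
  rw [Matrix.neg_mulVec, dotProduct_neg, hy] at h1
  simp only [sumElim_dotProduct_sumElim, kernelF_mulVec] at h1
  have nn : ∀ {ι : Type} [Fintype ι] (v : ι → ℝ), 0 ≤ v ⬝ᵥ v := fun v =>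
    Finset.sum_nonneg fun _ _ => mul_self_nonneg _
  have hB := moment_dotProduct_kronecker_le hr hgc hon H.posDef_U.posSemidef hx t
  rw [← he] at hB
  have hxx : Continuous fun t => x t ⬝ᵥ x t := by
    simpa using continuous_dotProduct_mulVec (1 : Matrix (StateIx n p) (StateIx n p) ℝ) hx
  have hcU := continuous_dotProduct_mulVec U hx
  have ht : Continuous fun τ : ℝ => t + τ := by fun_prop
  have hI : εU * (∫ τ in (-r)..0, x (t + τ) ⬝ᵥ x (t + τ))
      ≤ ∫ τ in (-r)..0, x (t + τ) ⬝ᵥ (U *ᵥ x (t + τ)) := by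
    rw [← intervalIntegral.integral_const_mul]
    exact intervalIntegral.integral_mono_on (by linarith)
      (((hxx.comp ht).const_mul _).intervalIntegrable _ _)
      ((hcU.comp ht).intervalIntegrable _ _) fun τ _ => hU _
  have hI0 : 0 ≤ ∫ τ in (-r)..0, x (t + τ) ⬝ᵥ x (t + τ) :=
    intervalIntegral.integral_nonneg (by linarith) fun τ _ => nn _
  set I := ∫ τ in (-r)..0, x (t + τ) ⬝ᵥ (U *ᵥ x (t + τ))
  set I1 := ∫ τ in (-r)..0, x (t + τ) ⬝ᵥ x (t + τ)
  set E := e ⬝ᵥ (((1 : Matrix (Fin d) (Fin d) ℝ) ⊗ₖ U) *ᵥ e)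
  have hE : E ≤ CU * (e ⬝ᵥ e) := hCU' e
  have b1 : E - I ≤ δ * (E - I) := by nlinarith
  have b2 : δ * E ≤ ε * (e ⬝ᵥ e) := by
    calc δ * E ≤ δ * (CU * (e ⬝ᵥ e)) := by gcongr
      _ = (δ * CU) * (e ⬝ᵥ e) := by ring
      _ ≤ _ := mul_le_mul_of_nonneg_right hδε (nn e)
  have b3 : δ * (εU * I1) ≤ δ * I := by gcongr
  have b4 : min ε (δ * εU) * (x t ⬝ᵥ x t) ≤ ε * (x t ⬝ᵥ x t) :=
    mul_le_mul_of_nonneg_right (min_le_left _ _) (nn _)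
  have b5 : min ε (δ * εU) * I1 ≤ δ * εU * I1 :=
    mul_le_mul_of_nonneg_right (min_le_right _ _) hI0
  have b6 := mul_nonneg hε.le (nn (x (t - r)))
  have b7 := mul_nonneg hε.le (nn w.ofLp)
  have b8 := mul_nonneg hε.le (nn y)
  simp only [PiHat] at h1
  linarith

/-! ### Solutions -/

/-- Pulling M out of the integral expresses the distributed terms of controller and output through
one and the same moment vector. -/
lemma integral_mulE_kernelF (hr : 0 ≤ r) (hf : ContinuousOn f (Icc (-r) 0)) {l : ℕ}
    (M : Matrix (Fin l) (KerIx n p d) ℝ) {χ : ℝ → State n p} {x : ℝ → StateIx n p → ℝ}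
    (hx : Continuous x) {t : ℝ} (h : ∀ τ ∈ Icc (-r) 0, (χ (t + τ)).ofLp = x (t + τ)) :
    (∫ τ in (-r)..0, mulE (M * kernelF n p r f τ) (χ (t + τ)))
      = WithLp.toLp 2 (M *ᵥ moment r (fun τ => sqrtF r f *ᵥ f τ) x t) := by
  have hu : uIcc (-r) 0 = Icc (-r) 0 := uIcc_of_le (by linarith)
  have hgk : ∀ i, ContinuousOn (fun τ => (sqrtF r f *ᵥ f τ) i) (uIcc (-r) 0) := fun i => by
    rw [hu]
    have hfk := continuousOn_pi.1 hf
    simp only [Matrix.mulVec, dotProduct]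
    fun_prop
  have hterm : ∀ i k, ContinuousOn
      (fun τ => M i k * ((sqrtF r f *ᵥ f τ) k.1 * x (t + τ) k.2)) (uIcc (-r) 0) := fun i k =>
    ((hgk k.1).mul (by fun_prop : Continuous fun τ => x (t + τ) k.2).continuousOn).const_mul _
  have e : EqOn (fun τ => mulE (M * kernelF n p r f τ) (χ (t + τ)))
      (fun τ => WithLp.toLp 2 fun i => ∑ k, M i k * ((sqrtF r f *ᵥ f τ) k.1 * x (t + τ) k.2))
      (uIcc (-r) 0) := by
    intro τ hτ
    simp only [mulE, Matrix.toLpLin_apply, h τ (hu ▸ hτ)]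
    rw [← Matrix.mulVec_mulVec, kernelF_mulVec]
    rfl
  rw [intervalIntegral.integral_congr e]
  ext i
  have hci : ContinuousOn (fun τ => (WithLp.toLp 2 fun i =>
      ∑ k, M i k * ((sqrtF r f *ᵥ f τ) k.1 * x (t + τ) k.2) : EuclideanSpace ℝ (Fin l)))
      (uIcc (-r) 0) :=
    (PiLp.continuous_toLp 2 _).comp_continuousOn
      (continuousOn_pi.2 fun i => continuousOn_finsetSum _ fun k _ => hterm i k)
  have hc := ContinuousLinearMap.intervalIntegral_comp_comm (μ := volume)
    (EuclideanSpace.proj (𝕜 := ℝ) i : EuclideanSpace ℝ (Fin l) →L[ℝ] ℝ) hci.intervalIntegrable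
  refine hc.symm.trans ?_
  simp only [PiLp.proj_apply]
  rw [intervalIntegral.integral_finsetSum fun k _ => (hterm i k).intervalIntegrable]
  simp only [intervalIntegral.integral_const_mul]
  rfl

/-- The coordinates of a solution, extended to the real line as a continuous function. -/
def trajectory (r t₀ : ℝ) (χ : ℝ → State n p) (t : ℝ) : StateIx n p → ℝ :=
  (χ (max t (t₀ - r))).ofLp

lemma trajectory_eq {t₀ : ℝ} (χ : ℝ → State n p) {t : ℝ} (ht : t₀ - r ≤ t) :
    trajectory r t₀ χ t = (χ t).ofLp := by
  rw [trajectory, max_eq_left ht]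

variable {t₀ : ℝ} {ψ : History n p r} {w : ℝ → EuclideanSpace ℝ (Fin q)} {χ : ℝ → State n p}

lemma IsSolution.continuous_trajectory (h : IsSolution G K r f t₀ ψ w χ) :
    Continuous (trajectory r t₀ χ) :=
  (PiLp.continuous_ofLp 2 _).comp <| h.continuousOn.comp_continuous (by fun_prop)
    fun t => mem_Ici.2 (le_max_right _ _)

lemma IsSolution.absolutelyContinuousOnInterval_trajectory (h : IsSolution G K r f t₀ ψ w χ)
    (hr : 0 ≤ r) {T : ℝ} (hT : t₀ ≤ T) (i : StateIx n p) :
    AbsolutelyContinuousOnInterval (fun t => trajectory r t₀ χ t i) t₀ T := by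
  refine absolutelyContinuousOnInterval_of_dist_le (h.absCont T hT) fun s hs t ht => ?_
  rw [uIcc_of_le hT] at hs ht
  rw [trajectory_eq χ (by linarith [hs.1]), trajectory_eq χ (by linarith [ht.1]), dist_eq_norm,
    dist_eq_norm]
  exact PiLp.norm_apply_le (χ s - χ t) i

lemma IsSolution.output_eq (h : IsSolution G K r f t₀ ψ w χ) (hr : 0 ≤ r)
    (hf : ContinuousOn f (Icc (-r) 0))
    (hC₃ : ∀ τ ∈ Icc (-r) 0, G.Ct₃ τ = C₃ * kernelF n p r f τ) {t : ℝ} (ht : t₀ ≤ t) :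
    output G r w χ t = outputOf G C₃ (trajectory r t₀ χ t) (trajectory r t₀ χ (t - r))
      (moment r (fun τ => sqrtF r f *ᵥ f τ) (trajectory r t₀ χ) t) (w t) := by
  have e : ∫ τ in (-r)..0, mulE (G.Ct₃ τ) (χ (t + τ))
      = ∫ τ in (-r)..0, mulE (C₃ * kernelF n p r f τ) (χ (t + τ)) :=
    intervalIntegral.integral_congr fun τ hτ => by
      rw [uIcc_of_le (by linarith)] at hτ
      simp only [hC₃ τ hτ]
  rw [output, e, integral_mulE_kernelF hr hf C₃ h.continuous_trajectory fun τ hτ =>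
      (trajectory_eq χ (by linarith [hτ.1])).symm,
    trajectory_eq χ (by linarith), trajectory_eq χ (by linarith)]
  simp only [mulE, Matrix.toLpLin_apply, outputOf, WithLp.toLp_add]

lemma IsSolution.ae_hasDerivAt_trajectory (h : IsSolution G K r f t₀ ψ w χ) (hr : 0 ≤ r)
    (hf : ContinuousOn f (Icc (-r) 0)) :
    ∀ᵐ t ∂volume.restrict (Ici t₀), t₀ < t ∧ HasDerivAt (trajectory r t₀ χ)
      (closedLoopField G K (trajectory r t₀ χ t) (trajectory r t₀ χ (t - r))
        (moment r (fun τ => sqrtF r f *ᵥ f τ) (trajectory r t₀ χ) t) (w t).ofLp) t := by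
  -- The null endpoint is discarded: for t > t₀ a whole neighbourhood lies where `trajectory` agrees
  -- with χ, as a two-sided derivative requires, even if r = 0.
  have hlt : ∀ᵐ t ∂volume.restrict (Ici t₀), t₀ < t := by
    rw [← Measure.restrict_congr_set Ioi_ae_eq_Ici]
    exact ae_restrict_mem measurableSet_Ioi
  filter_upwards [hlt, h.deriv] with t ht hd
  refine ⟨ht, ?_⟩
  have hev : trajectory r t₀ χ =ᶠ[nhds t] fun s => (χ s).ofLp := by
    filter_upwards [lt_mem_nhds ht] with s hs
    exact trajectory_eq χ (by linarith)
  have h1 := (PiLp.continuousLinearEquiv 2 ℝ fun _ : StateIx n p => ℝ).hasFDerivAt.comp_hasDerivAt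
    t hd
  refine (h1.congr_of_eventuallyEq hev).congr_deriv ?_
  have e1 := trajectory_eq (r := r) (t₀ := t₀) χ (t := t) (by linarith)
  have e2 := trajectory_eq (r := r) (t₀ := t₀) χ (t := t - r) (by linarith)
  have e3 := integral_mulE_kernelF hr hf K.K₃ h.continuous_trajectory (χ := χ) (t := t)
    fun τ hτ => (trajectory_eq χ (by linarith [hτ.1])).symm
  ext (i | i)
  · change (plantField G r w χ t).ofLp i = _
    simp only [plantField, closedLoopField, Sum.elim_inl, mulE, Matrix.toLpLin_apply, e1, e2]
    rfl
  · change (controllerField G K r f w χ t).ofLp i = _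
    rw [controllerField, e3]
    simp only [closedLoopField, Sum.elim_inr, mulE, Matrix.toLpLin_apply, e1, e2]
    rfl

lemma IsSolution.storage_chiSegment (h : IsSolution G K r f t₀ ψ w χ) (hr : 0 ≤ r)
    (g : ℝ → Fin d → ℝ) (P S U : Matrix (StateIx n p) (StateIx n p) ℝ)
    (Q : Matrix (StateIx n p) (KerIx n p d) ℝ) (R : Matrix (KerIx n p d) (KerIx n p d) ℝ) {t : ℝ}
    (ht : t₀ ≤ t) :
    storage r g P S U Q R (historyExtend (neg_nonpos.2 hr) (chiSegment r χ t)) 0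
      = storage r g P S U Q R (trajectory r t₀ χ) t := by
  refine storage_congr hr _ _ _ _ _ _ fun τ hτ => ?_
  have hc : Continuous fun θ : Icc (-r) 0 => χ (t + θ) :=
    h.continuousOn.comp_continuous (by fun_prop) fun θ => by
      have := θ.2.1
      simp only [mem_Ici]
      linarith
  rw [zero_add, historyExtend, IccExtend_of_mem _ _ hτ, chiSegment, dif_pos hc,
    trajectory_eq χ (by linarith [hτ.1])]
  rfl

/-! ### Dissipativity and stability -/

theorem IsFeasible.isDissipative (H : IsFeasible G K r f Pi C₃ J P Q R S U)
    (hC₃ : ∀ τ ∈ Icc (-r) 0, G.Ct₃ τ = C₃ * kernelF n p r f τ) :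
    IsDissipative G K r f J := by
  have hr := H.delay_nonneg
  have hf : ContinuousOn f (Icc (-r) 0) := fun τ hτ => (H.kernel τ hτ).continuousWithinAt
  have hg := hasDerivWithinAt_sqrtF_mulVec H.gram_posDef H.kernel
  have hgc : ContinuousOn (fun τ => sqrtF r f *ᵥ f τ) (Icc (-r) 0) :=
    fun τ hτ => (hg τ hτ).continuousWithinAt
  obtain ⟨β, hβ, hdec⟩ := H.exists_decay
  refine ⟨_, differentiable_storage_historyExtend (neg_nonpos.2 hr) hgc P S U Q R,
    fun t₀ ψ w χ _ hχ => ⟨fun T hT => ?_, ?_⟩⟩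
  · refine absolutelyContinuousOnInterval_of_dist_le
      (absolutelyContinuousOnInterval_storage (P := P) (S := S) (U := U) (Q := Q) (R := R) hr hg
        hχ.continuous_trajectory (hχ.absolutelyContinuousOnInterval_trajectory hr hT))
      fun s hs t ht => ?_
    rw [uIcc_of_le hT] at hs ht
    rw [hχ.storage_chiSegment hr _ _ _ _ _ _ hs.1, hχ.storage_chiSegment hr _ _ _ _ _ _ ht.1]
  · filter_upwards [hχ.ae_hasDerivAt_trajectory hr hf] with t ⟨ht, hd⟩
    obtain ⟨v', hv', hle⟩ := hdec _ _ t hχ.continuous_trajectory hd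
    refine ⟨v', hv'.congr_of_eventuallyEq ?_, ?_⟩
    · filter_upwards [lt_mem_nhds ht] with s hs
      exact hχ.storage_chiSegment hr _ _ _ _ _ _ hs.le
    · rw [hχ.output_eq hr hf hC₃ ht.le]
      refine hle.trans (mul_nonpos_of_nonpos_of_nonneg (by linarith) (add_nonneg ?_ ?_))
      · exact Finset.sum_nonneg fun _ _ => mul_self_nonneg _
      · exact intervalIntegral.integral_nonneg (by linarith) fun τ _ =>
          Finset.sum_nonneg fun _ _ => mul_self_nonneg _

lemma rate_zero_right_nonpos (hJ₁ : (-(J.J₁⁻¹)).PosDef) (z : EuclideanSpace ℝ (Fin m)) :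
    J.rate z 0 ≤ 0 := by
  rw [rate_eq]
  have h := hJ₁.posSemidef.dotProduct_mulVec_nonneg (J.Jt *ᵥ z.ofLp)
  rw [Matrix.neg_mulVec, dotProduct_neg, star_trivial] at h
  simp only [WithLp.ofLp_zero, Matrix.mulVec_zero, zero_dotProduct, mul_zero, add_zero]
  linarith

theorem IsFeasible.isExponentiallyStable (H : IsFeasible G K r f Pi C₃ J P Q R S U) :
    IsExponentiallyStable G K r f := by
  have hr := H.delay_nonneg
  have hf : ContinuousOn f (Icc (-r) 0) := fun τ hτ => (H.kernel τ hτ).continuousWithinAt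
  have hg := hasDerivWithinAt_sqrtF_mulVec H.gram_posDef H.kernel
  have hgc : ContinuousOn (fun τ => sqrtF r f *ᵥ f τ) (Icc (-r) 0) :=
    fun τ hτ => (hg τ hτ).continuousWithinAt
  have hon := isOrthonormal_sqrtF_mulVec hf hr H.gram_posDef
  obtain ⟨β, hβ, hdec⟩ := H.exists_decay
  obtain ⟨ε, hε, hlow⟩ := exists_pos_mul_le_storage hr hgc hon H.posDef_block
    H.posDef_S.posSemidef H.posDef_U.posSemidef
  obtain ⟨C, hC, hup⟩ := exists_pos_storage_le_mul hr hgc hon P S U Q R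
  -- From ε‖χ(t)‖² ≤ V(t) ≤ exp(−(β/C)(t−t₀)) V(t₀) and V(t₀) ≤ C(1+r)‖ψ‖²; taking the square root
  -- halves the rate.
  refine ⟨Real.sqrt (C * (1 + r) / ε), by positivity, β / C / 2, by positivity,
    fun t₀ ψ χ hχ t ht => ?_⟩
  set x := trajectory r t₀ χ with hx
  have hxc : Continuous x := hχ.continuous_trajectory
  have hnorm : ∀ s, t₀ - r ≤ s → x s ⬝ᵥ x s = ‖χ s‖ ^ 2 := fun s hs => by
    rw [hx, trajectory_eq χ hs, EuclideanSpace.real_norm_sq_eq]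
    simp [dotProduct, sq]
  have hdecay := le_exp_mul_of_ae_hasDerivAt_le (α := β / C) ht
    (absolutelyContinuousOnInterval_storage (P := P) (S := S) (U := U) (Q := Q) (R := R) hr hg
      hxc (hχ.absolutelyContinuousOnInterval_trajectory hr ht)) (by
    have hae := ae_restrict_of_ae_restrict_of_subset (show Icc t₀ t ⊆ Ici t₀ from fun s hs => hs.1)
      (hχ.ae_hasDerivAt_trajectory hr hf)
    filter_upwards [hae] with s ⟨_, hd⟩
    obtain ⟨v', hv', hle⟩ := hdec _ _ s hxc hd
    refine ⟨v', hv', ?_⟩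
    have h1 := rate_zero_right_nonpos H.supply (outputOf G C₃ (x s) (x (s - r))
      (moment r (fun τ => sqrtF r f *ᵥ f τ) x s) 0)
    -- The upper bound on the storage converts the decay −β(|x|² + ∫|x|²) into −(β/C)V.
    have h2 := mul_le_mul_of_nonneg_left (hup x hxc s) (by positivity : 0 ≤ β / C)
    have h3 : β / C * (C * (x s ⬝ᵥ x s + ∫ τ in (-r)..0, x (s + τ) ⬝ᵥ x (s + τ)))
        = β * (x s ⬝ᵥ x s + ∫ τ in (-r)..0, x (s + τ) ⬝ᵥ x (s + τ)) := by
      field_simp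
    linarith)
  have hψ : ∀ τ ∈ Icc (-r) 0, x (t₀ + τ) ⬝ᵥ x (t₀ + τ) ≤ ‖ψ‖ ^ 2 := fun τ hτ => by
    rw [hnorm _ (by linarith [hτ.1]), hχ.initial ⟨τ, hτ⟩]
    exact pow_le_pow_left₀ (norm_nonneg _) (ψ.norm_coe_le_norm _) 2
  have hinit : storage r (fun τ => sqrtF r f *ᵥ f τ) P S U Q R x t₀ ≤ C * ((1 + r) * ‖ψ‖ ^ 2) := by
    refine (hup x hxc t₀).trans (mul_le_mul_of_nonneg_left ?_ hC.le)
    have h0 : x t₀ ⬝ᵥ x t₀ ≤ ‖ψ‖ ^ 2 := by simpa using hψ 0 ⟨by linarith, le_rfl⟩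
    have hxx : Continuous fun τ => x (t₀ + τ) ⬝ᵥ x (t₀ + τ) := by
      simpa using continuous_dotProduct_mulVec (1 : Matrix (StateIx n p) (StateIx n p) ℝ)
        (hxc.comp (continuous_const.add continuous_id : Continuous fun τ : ℝ => t₀ + τ))
    have h1 : ∫ τ in (-r)..0, x (t₀ + τ) ⬝ᵥ x (t₀ + τ) ≤ ∫ _ in (-r)..0, ‖ψ‖ ^ 2 :=
      intervalIntegral.integral_mono_on (by linarith) (hxx.intervalIntegrable _ _) (by simp) hψ
    rw [intervalIntegral.integral_const, smul_eq_mul] at h1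
    linarith
  have hfin := hlow x hxc t
  rw [hnorm t (by linarith)] at hfin
  have hexp : Real.exp (-(β / C) * (t - t₀)) = Real.exp (-(β / C / 2) * (t - t₀)) ^ 2 := by
    rw [← Real.exp_nat_mul]; congr 1; push_cast; ring
  refine le_of_pow_le_pow_left₀ two_ne_zero (by positivity) ?_
  rw [mul_pow, mul_pow, Real.sq_sqrt (by positivity), ← hexp, div_mul_eq_mul_div,
    div_mul_eq_mul_div, le_div_iff₀ hε]
  have := mul_le_mul_of_nonneg_left hinit (Real.exp_pos (-(β / C) * (t - t₀))).le
  linarith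

theorem IsExponentiallyStable.isUniformlyAsymptoticallyStable
    (h : IsExponentiallyStable G K r f) : IsUniformlyAsymptoticallyStable G K r f := by
  obtain ⟨c, hc, α, hα, H⟩ := h
  refine ⟨fun ε hε => ⟨ε / c, by positivity, fun t₀ ψ χ hχ hψ t ht => ?_⟩, fun ρ hρ ε hε => ?_⟩
  · have h1 : Real.exp (-α * (t - t₀)) ≤ 1 :=
      Real.exp_le_one_iff.2 (by nlinarith)
    calc ‖χ t‖ ≤ c * Real.exp (-α * (t - t₀)) * ‖ψ‖ := H t₀ ψ χ hχ t ht
      _ ≤ c * 1 * ‖ψ‖ := by gcongr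
      _ < c * 1 * (ε / c) := by gcongr
      _ = ε := by field_simp
  · have hlim : Filter.Tendsto (fun T => c * Real.exp (-α * T) * ρ) Filter.atTop (nhds 0) := by
      have h1 : Filter.Tendsto (fun T => Real.exp (-α * T)) Filter.atTop (nhds 0) :=
        Real.tendsto_exp_atBot.comp (Filter.tendsto_id.const_mul_atTop_of_neg (by linarith))
      simpa using (h1.const_mul c).mul_const ρ
    obtain ⟨T, hTε, hT0⟩ := ((hlim.eventually (gt_mem_nhds hε)).and
      (Filter.eventually_ge_atTop 0)).exists
    refine ⟨T, hT0, fun t₀ ψ χ hχ hψ t ht => ?_⟩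
    calc ‖χ t‖ ≤ c * Real.exp (-α * (t - t₀)) * ‖ψ‖ := H t₀ ψ χ hχ t (by linarith)
      _ ≤ c * Real.exp (-α * T) * ρ := by
        have : -α * (t - t₀) ≤ -α * T := by nlinarith
        gcongr
      _ < ε := hTε

end Synthesis

end InputDelay

/-! ### The synthesis theorem. -/

theorem theorem9
    (n p d q m : ℕ) (r : ℝ) (hr : 0 < r)
    -- the plant, the supply rate
    (G : Plant n p q m) (J : Supply q m)
    (hJ₁ : (-(J.J₁⁻¹)).PosDef) (hJ₃ : J.J₃.IsSymm)
    -- the basis functions, and the decomposition of the distributed output kernel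
    (f : ℝ → Fin d → ℝ) (Pi : Matrix (Fin d) (Fin d) ℝ)
    (hf : ∀ τ ∈ Icc (-r) 0, HasDerivWithinAt f (Pi *ᵥ f τ) (Icc (-r) 0) τ)
    (hF : (gram r f).PosDef)
    (C₃ : Matrix (Fin m) (KerIx n p d) ℝ)
    (hC₃ : ∀ τ ∈ Icc (-r) 0, G.Ct₃ τ = C₃ * kernelF n p r f τ) :
    (∀ (P : Matrix (StateIx n p) (StateIx n p) ℝ) (Q : Matrix (StateIx n p) (KerIx n p d) ℝ)
        (R : Matrix (KerIx n p d) (KerIx n p d) ℝ)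
        (S U : Matrix (StateIx n p) (StateIx n p) ℝ) (K : Gains n p d),
        P.IsSymm → R.IsSymm → S.IsSymm → U.IsSymm →
        (Matrix.fromBlocks P Q Qᵀ (R + (1 : Matrix (Fin d) (Fin d) ℝ) ⊗ₖ S)).PosDef →
        S.PosDef → U.PosDef →
        (-(PhiHat G K r f Pi C₃ J P Q R S U)).PosDef →
        IsDissipative G K r f J ∧
        IsUniformlyAsymptoticallyStable G K r f ∧
        IsExponentiallyStable G K r f) ∧
    (numDecisionVars n p d : ℝ) =
      (0.5 * (d : ℝ) ^ 2 + d + 1.5) * ((n + p : ℕ) : ℝ) ^ 2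
        + (0.5 * d + p * d + 2 * p + 1.5) * ((n + p : ℕ) : ℝ) ∧
    (∃ c : ℝ, 0 < c ∧ ∀ n' p' d' : ℕ, 1 ≤ d' →
      (numDecisionVars n' p' d' : ℝ) ≤ c * ((d' : ℝ) ^ 2 * ((n' + p' : ℕ) : ℝ) ^ 2)) := by
  refine ⟨fun P Q R S U K hP hR _ _ hPQR hS hU hΦ => ?_, numDecisionVars_eq n p d,
    9, by norm_num, numDecisionVars_le⟩
  have H : IsFeasible G K r f Pi C₃ J P Q R S U :=
    ⟨hr.le, hJ₁, hf, hF, hP, hR, hPQR, hS, hU, hΦ⟩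
  exact ⟨H.isDissipative hC₃, H.isExponentiallyStable.isUniformlyAsymptoticallyStable,
    H.isExponentiallyStable⟩
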